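/- All Hilbert spaces are finite-dimensional and complex, each with a fixed computational basis. For an operator $A:X\to Y$ put $|A\rangle\!\rangle=\sum_i|i\rangle\otimes A|i\rangle\in X\otimes Y$. A supermap taking pairs of maps $\mathcal L(A_I)\to\mathcal L(A_O)$, $\mathcal L(B_I)\to\mathcal L(B_O)$ (slots $A$ and $B$) to maps $\mathcal L(P)\to\mathcal L(F)$ is identified with its Choi operator $W$, and acts on Choi operators by the link product $W*E=\mathrm{Tr}_Y[(W\otimes 1)(1\otimes E^{T_Y})]$ ($Y$ the common spaces). It is a *superchannel* if for all auxiliary spaces and all channels $\mathcal E_A:\mathcal L(A_I\otimes A_I')\to\mathcal L(A_O\otimes A_O')$, $\mathcal E_B:\mathcal L(B_I\otimes B_I')\to\mathcal L(B_O\otimes B_O')$ with Choi operators $E_A,E_B$, $W*(E_A\otimes E_B)$ is the Choi operator of a channel (a completely positive trace-preserving map) $\mathcal L(P\otimes A_I'\otimes B_I')\to\mathcal L(F\otimes A_O'\otimes B_O')$; it is *pure* if moreover any two unitary channels are always taken to a unitary channel. One-slot superchannels are defined in the same way. A *quantum comb of $A\prec B$* is such a supermap $R$ for which, for all auxiliary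 spaces $A_I',B_O'$ and every one-slot superchannel $S:[\mathcal L(A_O)\to\mathcal L(B_I)]\to[\mathcal L(A_I\otimes A_I')\to\mathcal L(B_O\otimes B_O')]$, $R*S$ is the Choi operator of a channel $\mathcal L(P\otimes A_I')\to\mathcal L(F\otimes B_O')$; combs of $B\prec A$ are defined by exchanging $A$ and $B$. A unitary $U:P\otimes A_O\otimes B_O\to A_I\otimes B_I\otimes F$ *represents* the supermap with Choi operator $|U\rangle\!\rangle\langle\!\langle U|$; it is *causally ordered* if it represents a comb of $A\prec B$ or of $B\prec A$. It represents a *direct sum of pure combs* if $U=U^{A\prec B}\oplus U^{B\prec A}$ for orthogonal decompositions $P=P^{A\prec B}\oplus P^{B\prec A}$, $F=F^{A\prec B}\oplus F^{B\prec A}$ (a summand may be zero) and unitaries $U^{A\prec B}:P^{A\prec B}\otimes A_O\otimes B_O\to A_I\otimes B_I\otimes F^{A\prec B}$ and $U^{B\prec A}:P^{B\prec A}\otimes A_O\otimes B_O\to A_I\otimes B_I\otimes F^{B\prec A}$ that represent a comb of $A\prec B$ and a comb of $B\prec A$, respectively. Let $U:P\otimes A_O\otimes B_O\to A_I\otimes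 B_I\otimes F$ be a unitary operator that represents a pure superchannel with two slots, or a direct sum of pure combs. Suppose $\dim A_I=\dim A_O=\dim B_I=\dim B_O=d$ and $\dim P=\dim F=D$. (1) If $D=d$, then $U$ is causally ordered, and either $$U=U_0^{P\to A_I}\otimes U_1^{A_O\to B_I}\otimes U_2^{B_O\to F}$$ for unitary operators $U_0:P\to A_I$, $U_1:A_O\to B_I$, $U_2:B_O\to F$, or $$U=V_0^{P\to B_I}\otimes V_1^{B_O\to A_I}\otimes V_2^{A_O\to F}$$ for unitary operators $V_0:P\to B_I$, $V_1:B_O\to A_I$, $V_2:A_O\to F$. (2) If $D=2d$, then $U$ is causally ordered, or $U$ is switch-like: there are identifications (by unitary operators) $P=P_c\otimes P_t$ and $F=F_c\otimes F_t$ with $\dim P_c=\dim F_c=2$, $\dim P_t=\dim F_t=d$, and unitary operators $U_0:P_t\to A_I$, $U_1:A_O\to B_I$, $U_2:B_O\to F_t$, $V_0:P_t\to B_I$, $V_1:B_O\to A_I$, $V_2:A_O\to F_t$ such that $$U=|0\rangle^{F_c}\langle 0|^{P_c}\otimes U_0^{P_t\to A_I}\otimes U_1^{A_O\to B_I}\otimes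 U_2^{B_O\to F_t}+|1\rangle^{F_c}\langle 1|^{P_c}\otimes V_0^{P_t\to B_I}\otimes V_1^{B_O\to A_I}\otimes V_2^{A_O\to F_t},$$ with Choi vector, in the product bases of $P_c\otimes P_t$ and $F_c\otimes F_t$, $$|U\rangle\!\rangle=|0\rangle^{P_c}|U_0\rangle\!\rangle^{P_tA_I}|U_1\rangle\!\rangle^{A_OB_I}|U_2\rangle\!\rangle^{B_OF_t}|0\rangle^{F_c}+|1\rangle^{P_c}|V_0\rangle\!\rangle^{P_tB_I}|V_1\rangle\!\rangle^{B_OA_I}|V_2\rangle\!\rangle^{A_OF_t}|1\rangle^{F_c}.$$ -/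

import Mathlib

open scoped Kronecker ComplexOrder

namespace QSC

/-! A finite-dimensional Hilbert space with its computational basis is `ℂ^X`, given by the finite
index type `X` of the basis. Operators `X → Y` are matrices `Matrix Y X ℂ`; tensor products of
spaces are products of index types. -/

/-- A unitary operator between two (possibly different) Hilbert spaces. -/
def IsUnitaryOp {X Y : Type} [Fintype X] [DecidableEq X] [Fintype Y] [DecidableEq Y]
    (A : Matrix Y X ℂ) : Prop :=
  A.conjTranspose * A = 1 ∧ A * A.conjTranspose = 1

/-! ### Choi operators, quantum channels, link product -/

/-- Choi vector `|A⟩⟩ = ∑ i, |i⟩ ⊗ A|i⟩` of an operator. -/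
def choiVec {X Y : Type} (A : Matrix Y X ℂ) : X × Y → ℂ := fun z => A z.2 z.1

/-- The rank-one operator `|A⟩⟩⟨⟨A|`. -/
def choiProj {X Y : Type} (A : Matrix Y X ℂ) : Matrix (X × Y) (X × Y) ℂ :=
  Matrix.vecMulVec (choiVec A) (star (choiVec A))

/-- Choi operator `∑ i i', |i⟩⟨i'| ⊗ Φ(|i⟩⟨i'|)` of a linear map between operator spaces. -/
def choiOp {X Y : Type} [DecidableEq X] (Φ : Matrix X X ℂ →ₗ[ℂ] Matrix Y Y ℂ) :
    Matrix (X × Y) (X × Y) ℂ :=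
  Matrix.of fun z w => Φ (Matrix.single z.1 w.1 1) z.2 w.2

/-- The map `id_R ⊗ Φ`, applied blockwise. -/
def ampliate {X Y : Type} (R : Type) (Φ : Matrix X X ℂ →ₗ[ℂ] Matrix Y Y ℂ)
    (ρ : Matrix (R × X) (R × X) ℂ) : Matrix (R × Y) (R × Y) ℂ :=
  Matrix.of fun z w => Φ (Matrix.of fun i j => ρ (z.1, i) (w.1, j)) z.2 w.2

/-- Quantum channels: completely positive trace-preserving maps. -/
def IsQuantumChannel {X Y : Type} [Fintype X] [Fintype Y]
    (Φ : Matrix X X ℂ →ₗ[ℂ] Matrix Y Y ℂ) : Prop :=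
  (∀ (R : Type) [Fintype R] (ρ : Matrix (R × X) (R × X) ℂ),
      ρ.PosSemidef → (ampliate R Φ ρ).PosSemidef) ∧
  ∀ ρ : Matrix X X ℂ, (Φ ρ).trace = ρ.trace

/-- `E` is the Choi operator of a quantum channel `L(X) → L(Y)`. -/
def IsChannelChoi {X Y : Type} [Fintype X] [DecidableEq X] [Fintype Y]
    (E : Matrix (X × Y) (X × Y) ℂ) : Prop :=
  ∃ Φ : Matrix X X ℂ →ₗ[ℂ] Matrix Y Y ℂ, IsQuantumChannel Φ ∧ E = choiOp Φ

/-- Partial transposition on the first tensor factor. -/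
def partialTransposeFst {Y Z : Type} (M : Matrix (Y × Z) (Y × Z) ℂ) :
    Matrix (Y × Z) (Y × Z) ℂ :=
  Matrix.of fun a b => M (b.1, a.2) (a.1, b.2)

/-- Partial trace over the middle tensor factor. -/
def partialTraceMid {X Y Z : Type} [Fintype Y] (M : Matrix ((X × Y) × Z) ((X × Y) × Z) ℂ) :
    Matrix (X × Z) (X × Z) ℂ :=
  Matrix.of fun a b => ∑ y, M ((a.1, y), a.2) ((b.1, y), b.2)

/-- Link product `E ∗ F = Tr_Y [(E ⊗ 1_Z) (1_X ⊗ F^{T_Y})]`. -/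
def linkProduct {X Y Z : Type} [Fintype X] [DecidableEq X] [Fintype Y] [Fintype Z] [DecidableEq Z]
    (E : Matrix (X × Y) (X × Y) ℂ) (F : Matrix (Y × Z) (Y × Z) ℂ) :
    Matrix (X × Z) (X × Z) ℂ :=
  partialTraceMid ((E ⊗ₖ (1 : Matrix Z Z ℂ)) *
    ((1 : Matrix X X ℂ) ⊗ₖ partialTransposeFst F).submatrix
      (Equiv.prodAssoc X Y Z) (Equiv.prodAssoc X Y Z))

theorem linkProduct_apply {X Y Z : Type} [Fintype X] [DecidableEq X] [Fintype Y]
    [Fintype Z] [DecidableEq Z]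
    (E : Matrix (X × Y) (X × Y) ℂ) (F : Matrix (Y × Z) (Y × Z) ℂ) (x x' : X) (z z' : Z) :
    linkProduct E F (x, z) (x', z') =
      ∑ y, ∑ y', E (x, y) (x', y') * F (y, z) (y', z') := by
  simp [linkProduct, partialTraceMid, partialTransposeFst, Matrix.mul_apply,
    Fintype.sum_prod_type, Matrix.one_apply]

/-! ### Superchannels

A supermap is represented by its Choi operator `W` (the correspondence is bijective), and acts on
(Choi operators of) maps by the link product. -/

section OneSlot

variable {P AI AO F : Type}
  [Fintype P] [DecidableEq P] [Fintype AI] [DecidableEq AI] [Fintype AO] [DecidableEq AO]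
  [Fintype F] [DecidableEq F]

/-- `W ∗ E` for a one-slot supermap `W : [AI → AO] → [P → F]` acting on a part of
`E : AI ⊗ AI' → AO ⊗ AO'`; the result is on `P ⊗ AI' → F ⊗ AO'`. -/
def slotLink₁ {AI' AO' : Type} [Fintype AI'] [DecidableEq AI'] [Fintype AO'] [DecidableEq AO']
    (W : Matrix ((P × AO) × (AI × F)) ((P × AO) × (AI × F)) ℂ)
    (E : Matrix ((AI × AI') × (AO × AO')) ((AI × AI') × (AO × AO')) ℂ) :
    Matrix ((P × AI') × (F × AO')) ((P × AI') × (F × AO')) ℂ :=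
  let W' : Matrix ((P × F) × (AI × AO)) ((P × F) × (AI × AO)) ℂ :=
    W.submatrix (fun ((p, f), (ai, ao)) => ((p, ao), (ai, f)))
      (fun ((p, f), (ai, ao)) => ((p, ao), (ai, f)))
  let E' : Matrix ((AI × AO) × (AI' × AO')) ((AI × AO) × (AI' × AO')) ℂ :=
    E.submatrix (fun ((ai, ao), (ai', ao')) => ((ai, ai'), (ao, ao')))
      (fun ((ai, ao), (ai', ao')) => ((ai, ai'), (ao, ao')))
  (linkProduct W' E').submatrix (fun ((p, ai'), (f, ao')) => ((p, f), (ai', ao')))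
    (fun ((p, ai'), (f, ao')) => ((p, f), (ai', ao')))

/-- Quantum superchannels with one slot `AI → AO`. These are also the quantum combs
with one slot. -/
def IsSuperchannel₁ (W : Matrix ((P × AO) × (AI × F)) ((P × AO) × (AI × F)) ℂ) : Prop :=
  ∀ (AI' AO' : Type) [Fintype AI'] [DecidableEq AI'] [Fintype AO'] [DecidableEq AO']
    (E : Matrix ((AI × AI') × (AO × AO')) ((AI × AI') × (AO × AO')) ℂ),
    IsChannelChoi E → IsChannelChoi (slotLink₁ W E)

end OneSlot

section TwoSlots

variable {P AI AO BI BO F : Type}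
  [Fintype P] [DecidableEq P] [Fintype AI] [DecidableEq AI] [Fintype AO] [DecidableEq AO]
  [Fintype BI] [DecidableEq BI] [Fintype BO] [DecidableEq BO] [Fintype F] [DecidableEq F]

/-- `W ∗ (EA ⊗ EB)` for a two-slot supermap `W : [AI → AO] ⊗ [BI → BO] → [P → F]` acting on parts
of `EA : AI ⊗ AI' → AO ⊗ AO'` and `EB : BI ⊗ BI' → BO ⊗ BO'`; the result is on
`P ⊗ AI' ⊗ BI' → F ⊗ AO' ⊗ BO'`. -/
def slotLink₂ {AI' AO' BI' BO' : Type}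
    [Fintype AI'] [DecidableEq AI'] [Fintype AO'] [DecidableEq AO']
    [Fintype BI'] [DecidableEq BI'] [Fintype BO'] [DecidableEq BO']
    (W : Matrix ((P × AO × BO) × (AI × BI × F)) ((P × AO × BO) × (AI × BI × F)) ℂ)
    (EA : Matrix ((AI × AI') × (AO × AO')) ((AI × AI') × (AO × AO')) ℂ)
    (EB : Matrix ((BI × BI') × (BO × BO')) ((BI × BI') × (BO × BO')) ℂ) :
    Matrix ((P × AI' × BI') × (F × AO' × BO')) ((P × AI' × BI') × (F × AO' × BO')) ℂ :=
  let W' : Matrix ((P × F) × (AI × AO × BI × BO)) ((P × F) × (AI × AO × BI × BO)) ℂ :=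
    W.submatrix (fun ((p, f), (ai, ao, bi, bo)) => ((p, ao, bo), (ai, bi, f)))
      (fun ((p, f), (ai, ao, bi, bo)) => ((p, ao, bo), (ai, bi, f)))
  let E' : Matrix ((AI × AO × BI × BO) × (AI' × AO' × BI' × BO'))
      ((AI × AO × BI × BO) × (AI' × AO' × BI' × BO')) ℂ :=
    (EA ⊗ₖ EB).submatrix
      (fun ((ai, ao, bi, bo), (ai', ao', bi', bo')) =>
        (((ai, ai'), (ao, ao')), ((bi, bi'), (bo, bo'))))
      (fun ((ai, ao, bi, bo), (ai', ao', bi', bo')) =>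
        (((ai, ai'), (ao, ao')), ((bi, bi'), (bo, bo'))))
  (linkProduct W' E').submatrix
    (fun ((p, ai', bi'), (f, ao', bo')) => ((p, f), (ai', ao', bi', bo')))
    (fun ((p, ai', bi'), (f, ao', bo')) => ((p, f), (ai', ao', bi', bo')))

/-- Quantum superchannels with two slots `A` and `B`. -/
def IsSuperchannel₂
    (W : Matrix ((P × AO × BO) × (AI × BI × F)) ((P × AO × BO) × (AI × BI × F)) ℂ) : Prop :=
  ∀ (AI' AO' BI' BO' : Type) [Fintype AI'] [DecidableEq AI'] [Fintype AO'] [DecidableEq AO']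
    [Fintype BI'] [DecidableEq BI'] [Fintype BO'] [DecidableEq BO']
    (EA : Matrix ((AI × AI') × (AO × AO')) ((AI × AI') × (AO × AO')) ℂ)
    (EB : Matrix ((BI × BI') × (BO × BO')) ((BI × BI') × (BO × BO')) ℂ),
    IsChannelChoi EA → IsChannelChoi EB → IsChannelChoi (slotLink₂ W EA EB)

/-- Pure superchannels with two slots: superchannels which map pairs of unitary channels to
unitary channels, also when acting on subsystems. -/
def IsPureSuperchannel
    (W : Matrix ((P × AO × BO) × (AI × BI × F)) ((P × AO × BO) × (AI × BI × F)) ℂ) : Prop :=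
  IsSuperchannel₂ W ∧
  ∀ (AI' AO' BI' BO' : Type) [Fintype AI'] [DecidableEq AI'] [Fintype AO'] [DecidableEq AO']
    [Fintype BI'] [DecidableEq BI'] [Fintype BO'] [DecidableEq BO']
    (UA : Matrix (AO × AO') (AI × AI') ℂ) (UB : Matrix (BO × BO') (BI × BI') ℂ),
    IsUnitaryOp UA → IsUnitaryOp UB →
      ∃ UG : Matrix (F × AO' × BO') (P × AI' × BI') ℂ,
        IsUnitaryOp UG ∧ choiProj UG = slotLink₂ W (choiProj UA) (choiProj UB)

/-! ### Quantum combs with two slots -/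

/-- `R ∗ S` for a two-slot supermap `R : [AI → AO] ⊗ [BI → BO] → [P → F]` and a one-slot supermap
`S : [AO → BI] → [AI ⊗ AI' → BO ⊗ BO']`; the result is on `P ⊗ AI' → F ⊗ BO'`. -/
def combLink {AI' BO' : Type} [Fintype AI'] [DecidableEq AI'] [Fintype BO'] [DecidableEq BO']
    (R : Matrix ((P × AO × BO) × (AI × BI × F)) ((P × AO × BO) × (AI × BI × F)) ℂ)
    (S : Matrix (((AI × AI') × BI) × (AO × (BO × BO'))) (((AI × AI') × BI) × (AO × (BO × BO'))) ℂ) :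
    Matrix ((P × AI') × (F × BO')) ((P × AI') × (F × BO')) ℂ :=
  let R' : Matrix ((P × F) × (AI × AO × BI × BO)) ((P × F) × (AI × AO × BI × BO)) ℂ :=
    R.submatrix (fun ((p, f), (ai, ao, bi, bo)) => ((p, ao, bo), (ai, bi, f)))
      (fun ((p, f), (ai, ao, bi, bo)) => ((p, ao, bo), (ai, bi, f)))
  let S' : Matrix ((AI × AO × BI × BO) × (AI' × BO')) ((AI × AO × BI × BO) × (AI' × BO')) ℂ :=
    S.submatrix (fun ((ai, ao, bi, bo), (ai', bo')) => (((ai, ai'), bi), (ao, (bo, bo'))))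
      (fun ((ai, ao, bi, bo), (ai', bo')) => (((ai, ai'), bi), (ao, (bo, bo'))))
  (linkProduct R' S').submatrix (fun ((p, ai'), (f, bo')) => ((p, f), (ai', bo')))
    (fun ((p, ai'), (f, bo')) => ((p, f), (ai', bo')))

/-- Quantum combs of `A ≺ B` (first slot `A`, second slot `B`): supermaps taking every one-slot
comb `[AO → BI] → [AI ⊗ AI' → BO ⊗ BO']` to a quantum channel. -/
def IsCombAB
    (R : Matrix ((P × AO × BO) × (AI × BI × F)) ((P × AO × BO) × (AI × BI × F)) ℂ) : Prop :=
  ∀ (AI' BO' : Type) [Fintype AI'] [DecidableEq AI'] [Fintype BO'] [DecidableEq BO']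
    (S : Matrix (((AI × AI') × BI) × (AO × (BO × BO')))
      (((AI × AI') × BI) × (AO × (BO × BO'))) ℂ),
    IsSuperchannel₁ S → IsChannelChoi (combLink R S)

/-- Quantum combs of `B ≺ A`: the same with the roles of the slots exchanged. -/
def IsCombBA
    (R : Matrix ((P × AO × BO) × (AI × BI × F)) ((P × AO × BO) × (AI × BI × F)) ℂ) : Prop :=
  IsCombAB (P := P) (AI := BI) (AO := BO) (BI := AI) (BO := AO) (F := F)
    (R.submatrix (fun ((p, bo, ao), (bi, ai, f)) => ((p, ao, bo), (ai, bi, f)))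
      (fun ((p, bo, ao), (bi, ai, f)) => ((p, ao, bo), (ai, bi, f))))

/-! ### Unitary operators representing supermaps -/

/-- The unitary operator `U` represents a pure superchannel with slots `A` and `B`. -/
def RepresentsPureSuperchannel (U : Matrix (AI × BI × F) (P × AO × BO) ℂ) : Prop :=
  IsUnitaryOp U ∧ IsPureSuperchannel (choiProj U)

/-- The unitary operator `U` represents a quantum comb of `A ≺ B`. -/
def RepresentsCombAB (U : Matrix (AI × BI × F) (P × AO × BO) ℂ) : Prop :=
  IsUnitaryOp U ∧ IsCombAB (choiProj U)

/-- The unitary operator `U` represents a quantum comb of `B ≺ A`. -/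
def RepresentsCombBA (U : Matrix (AI × BI × F) (P × AO × BO) ℂ) : Prop :=
  IsUnitaryOp U ∧ IsCombBA (choiProj U)

/-- `U` is causally ordered: it represents a quantum comb, for one of the two orders. -/
def IsCausallyOrdered (U : Matrix (AI × BI × F) (P × AO × BO) ℂ) : Prop :=
  RepresentsCombAB U ∨ RepresentsCombBA U

/-- The matrix of `U` when `P` and `F` are described in other orthonormal bases, formed by the
columns of the unitary matrices `S` and `T`. -/
def changeBasis {Q G : Type} [Fintype Q] [Fintype G] (S : Matrix P Q ℂ) (T : Matrix F G ℂ)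
    (U : Matrix (AI × BI × F) (P × AO × BO) ℂ) : Matrix (AI × BI × G) (Q × AO × BO) ℂ :=
  ((1 : Matrix AI AI ℂ) ⊗ₖ ((1 : Matrix BI BI ℂ) ⊗ₖ T.conjTranspose)) * U *
    (S ⊗ₖ ((1 : Matrix AO AO ℂ) ⊗ₖ (1 : Matrix BO BO ℂ)))

end TwoSlots

section Forms

variable {P AI AO BI BO F : Type}

/-- The direct sum `U₁ ⊕ U₂`, on `(P₁ ⊕ P₂) ⊗ AO ⊗ BO → AI ⊗ BI ⊗ (F₁ ⊕ F₂)`. -/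
def directSumOp {P₁ P₂ F₁ F₂ : Type} (U₁ : Matrix (AI × BI × F₁) (P₁ × AO × BO) ℂ)
    (U₂ : Matrix (AI × BI × F₂) (P₂ × AO × BO) ℂ) :
    Matrix (AI × BI × (F₁ ⊕ F₂)) ((P₁ ⊕ P₂) × AO × BO) ℂ :=
  (Matrix.fromBlocks U₁ 0 0 U₂).submatrix
    (fun (ai, bi, f) => Sum.map (fun f₁ => (ai, bi, f₁)) (fun f₂ => (ai, bi, f₂)) f)
    (fun (p, ao, bo) => Sum.map (fun p₁ => (p₁, ao, bo)) (fun p₂ => (p₂, ao, bo)) p)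

/-- The unitary operator `U` represents a direct sum of pure combs: for some orthogonal
decompositions of `P` and `F` into two subspaces (given by adapted orthonormal bases `S`, `T`),
`U` is the direct sum of a unitary comb of `A ≺ B` and a unitary comb of `B ≺ A`. -/
def RepresentsDirectSumOfPureCombs
    [Fintype P] [DecidableEq P] [Fintype AI] [DecidableEq AI] [Fintype AO] [DecidableEq AO]
    [Fintype BI] [DecidableEq BI] [Fintype BO] [DecidableEq BO] [Fintype F] [DecidableEq F]
    (U : Matrix (AI × BI × F) (P × AO × BO) ℂ) : Prop :=
  IsUnitaryOp U ∧
  ∃ (p₁ p₂ f₁ f₂ : ℕ) (S : Matrix P (Fin p₁ ⊕ Fin p₂) ℂ) (T : Matrix F (Fin f₁ ⊕ Fin f₂) ℂ)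
    (U₁ : Matrix (AI × BI × Fin f₁) (Fin p₁ × AO × BO) ℂ)
    (U₂ : Matrix (AI × BI × Fin f₂) (Fin p₂ × AO × BO) ℂ),
    IsUnitaryOp S ∧ IsUnitaryOp T ∧ RepresentsCombAB U₁ ∧ RepresentsCombBA U₂ ∧
    changeBasis S T U = directSumOp U₁ U₂

/-- `U₀^{P → AI} ⊗ U₁^{AO → BI} ⊗ U₂^{BO → F}`. -/
def orderedAB (U₀ : Matrix AI P ℂ) (U₁ : Matrix BI AO ℂ) (U₂ : Matrix F BO ℂ) :
    Matrix (AI × BI × F) (P × AO × BO) ℂ :=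
  U₀ ⊗ₖ (U₁ ⊗ₖ U₂)

/-- `V₀^{P → BI} ⊗ V₁^{BO → AI} ⊗ V₂^{AO → F}`. -/
def orderedBA (V₀ : Matrix BI P ℂ) (V₁ : Matrix AI BO ℂ) (V₂ : Matrix F AO ℂ) :
    Matrix (AI × BI × F) (P × AO × BO) ℂ :=
  (V₁ ⊗ₖ (V₀ ⊗ₖ V₂)).submatrix id (fun (p, ao, bo) => (bo, p, ao))

/-- `|c⟩^{Fc}⟨c|^{Pc} ⊗ M`, on `(Pc ⊗ Pt) ⊗ AO ⊗ BO → AI ⊗ BI ⊗ (Fc ⊗ Ft)`, for an operator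
`M : Pt ⊗ AO ⊗ BO → AI ⊗ BI ⊗ Ft`; both `Pc` and `Fc` are qubits. -/
def controlled {Pt Ft : Type} (c : Fin 2) (M : Matrix (AI × BI × Ft) (Pt × AO × BO) ℂ) :
    Matrix (AI × BI × (Fin 2 × Ft)) ((Fin 2 × Pt) × AO × BO) ℂ :=
  ((Matrix.single c c (1 : ℂ)) ⊗ₖ M).submatrix
    (fun (ai, bi, (fc, ft)) => (fc, (ai, bi, ft)))
    (fun ((pc, pt), ao, bo) => (pc, (pt, ao, bo)))

/-- `|c⟩^{Pc} |U₀⟩⟩^{Pt AI} |U₁⟩⟩^{AO BI} |U₂⟩⟩^{BO Ft} |c⟩^{Fc}`. -/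
def controlledVecAB {Pt Ft : Type} (c : Fin 2) (U₀ : Matrix AI Pt ℂ) (U₁ : Matrix BI AO ℂ)
    (U₂ : Matrix Ft BO ℂ) :
    ((Fin 2 × Pt) × AO × BO) × (AI × BI × (Fin 2 × Ft)) → ℂ :=
  fun (((pc, pt), ao, bo), (ai, bi, (fc, ft))) =>
    (Pi.single c 1 : Fin 2 → ℂ) pc * choiVec U₀ (pt, ai) * choiVec U₁ (ao, bi) *
      choiVec U₂ (bo, ft) * (Pi.single c 1 : Fin 2 → ℂ) fc

/-- `|c⟩^{Pc} |V₀⟩⟩^{Pt BI} |V₁⟩⟩^{BO AI} |V₂⟩⟩^{AO Ft} |c⟩^{Fc}`. -/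
def controlledVecBA {Pt Ft : Type} (c : Fin 2) (V₀ : Matrix BI Pt ℂ) (V₁ : Matrix AI BO ℂ)
    (V₂ : Matrix Ft AO ℂ) :
    ((Fin 2 × Pt) × AO × BO) × (AI × BI × (Fin 2 × Ft)) → ℂ :=
  fun (((pc, pt), ao, bo), (ai, bi, (fc, ft))) =>
    (Pi.single c 1 : Fin 2 → ℂ) pc * choiVec V₀ (pt, bi) * choiVec V₁ (bo, ai) *
      choiVec V₂ (ao, ft) * (Pi.single c 1 : Fin 2 → ℂ) fc

end Forms

end QSC

set_option linter.unusedSectionVars false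

/-! The argument lives in the Heisenberg picture: everything is read off `heis`, the blocks on `P`
of Uᴴ(|i⟩⟨j| ⊗ |k⟩⟨l| ⊗ 1)U. Trace preservation of the output for all pairs of inserted channels is
a family of linear constraints on these blocks. `functional_const_on_channels` solves them and
leaves three causality conditions, collected in `Admissible`. A direct sum of combs satisfies the
same conditions, so both alternatives of the hypothesis are treated together from there on.

For an admissible unitary, the pulled-back matrix units of `AI` act on P ⊗ BO (`unitsA`) and those
of `BI` on P ⊗ AO (`unitsB`); multiplied in either order they give `heis`. Subtracting their value
at a reference index leaves `jumpA` and `jumpB`, and the absence of loops becomes the equation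
`jumpA * jumpB = 0` on `P`. If every `jumpA` vanishes, U is a comb of A ≺ B; if every `jumpB`
vanishes, it is a comb of B ≺ A.

Otherwise a nonzero vector in the range of some `jumpB` is killed by every `jumpA`, so the matrix
units of `AI` move it inside `P` alone and span an isometric copy of ℂ^AI
(`MatrixUnits.exists_isometry`). Symmetrically there is a copy of ℂ^BI, and the two are orthogonal.
This is impossible for D = d, and for D = 2d the copies fill `P`. On the first copy the matrix units
of `BI` act as scalars on `P` and as d × d matrix units on `AO`, hence are standard up to a unitary;
this makes U a tensor product there (`Admissible.product_form`). The second copy is the mirror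
image, and together they form the switch. -/

namespace QSC

/-! ### Characterization of channels -/

theorem linkProduct_posSemidef {X Y Z : Type} [Fintype X] [DecidableEq X] [Fintype Y]
    [Fintype Z] [DecidableEq Z] {E : Matrix (X × Y) (X × Y) ℂ} {F : Matrix (Y × Z) (Y × Z) ℂ}
    (hE : E.PosSemidef) (hF : F.PosSemidef) : (linkProduct E F).PosSemidef := by
  classical
  -- The link product is a compression of E ⊗ F: the matrix below is 1_X ⊗ ⟨⟨1|_YY ⊗ 1_Z,
  -- contraction with the unnormalised maximally entangled vector.
  have h := (hE.kronecker hF).mul_mul_conjTranspose_same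
    (Matrix.of fun (u : X × Z) (w : (X × Y) × (Y × Z)) =>
      if u.1 = w.1.1 then if w.1.2 = w.2.1 then if u.2 = w.2.2 then (1 : ℂ) else 0 else 0 else 0)
  refine (congrArg Matrix.PosSemidef ?_).mpr h
  ext ⟨x, z⟩ ⟨x', z'⟩
  rw [linkProduct_apply, Finset.sum_comm]
  simp [Matrix.mul_apply, Fintype.sum_prod_type, apply_ite]

/-- The map with Choi operator `E`. -/
def mapOfChoi {X Y : Type} [Fintype X] (E : Matrix (X × Y) (X × Y) ℂ) :
    Matrix X X ℂ →ₗ[ℂ] Matrix Y Y ℂ where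
  toFun ρ := Matrix.of fun y y' => ∑ x, ∑ x', ρ x x' * E (x, y) (x', y')
  map_add' ρ σ := by
    ext y y'
    simp [add_mul, Finset.sum_add_distrib]
  map_smul' c ρ := by
    ext y y'
    simp [Finset.mul_sum, mul_assoc]

theorem ampliate_mapOfChoi {X Y R : Type} [Fintype X] [Fintype R] [DecidableEq R] [Fintype Y]
    [DecidableEq Y] (E : Matrix (X × Y) (X × Y) ℂ) (ρ : Matrix (R × X) (R × X) ℂ) :
    ampliate R (mapOfChoi E) ρ = linkProduct ρ E := by
  ext ⟨r, y⟩ ⟨r', y'⟩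
  rw [linkProduct_apply]
  rfl

/-- Choi's theorem: the maximally entangled input has the Choi operator as its output, and
conversely every ampliation is a link product with E. The trace condition is tested on matrix units.
-/
theorem isChannelChoi_iff {X Y : Type} [Fintype X] [DecidableEq X] [Fintype Y]
    (E : Matrix (X × Y) (X × Y) ℂ) :
    IsChannelChoi E ↔ E.PosSemidef ∧ ∀ x x', ∑ y, E (x, y) (x', y) = if x = x' then 1 else 0 := by
  classical
  constructor
  · rintro ⟨Φ, ⟨hcp, htr⟩, rfl⟩
    constructor
    · have h := hcp X (Matrix.vecMulVec (fun z : X × X => if z.1 = z.2 then (1 : ℂ) else 0)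
        (star (fun z : X × X => if z.1 = z.2 then (1 : ℂ) else 0)))
        (Matrix.posSemidef_vecMulVec_self_star _)
      refine (congrArg Matrix.PosSemidef ?_).mpr h
      ext ⟨x, y⟩ ⟨x', y'⟩
      simp only [choiOp, ampliate, Matrix.of_apply]
      have hs : Matrix.single x x' (1 : ℂ) = Matrix.of fun i j =>
          Matrix.vecMulVec (fun z : X × X => if z.1 = z.2 then (1 : ℂ) else 0)
            (star (fun z : X × X => if z.1 = z.2 then (1 : ℂ) else 0)) (x, i) (x', j) := by
        ext i j
        by_cases hi : x = i <;> by_cases hj : x' = j <;>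
          simp [Matrix.vecMulVec_apply, hi, hj]
      rw [hs]
    · intro x x'
      have h := htr (Matrix.single x x' 1)
      have h2 : (Matrix.single x x' (1 : ℂ)).trace = if x = x' then 1 else 0 := by
        split_ifs with hx
        · subst hx; simp
        · simp [hx]
      rw [h2] at h
      exact h
  · rintro ⟨hpos, htr⟩
    refine ⟨mapOfChoi E, ⟨fun R _ ρ hρ => ?_, fun ρ => ?_⟩, ?_⟩
    · rw [ampliate_mapOfChoi]
      exact linkProduct_posSemidef hρ hpos
    · simp only [Matrix.trace, Matrix.diag_apply, mapOfChoi, LinearMap.coe_mk, AddHom.coe_mk,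
        Matrix.of_apply]
      rw [Finset.sum_comm]
      refine Finset.sum_congr rfl fun x _ => ?_
      rw [Finset.sum_comm]
      simp [← Finset.mul_sum, htr]
    · ext ⟨x, y⟩ ⟨x', y'⟩
      simp [choiOp, mapOfChoi, Matrix.single_apply, ite_and]

theorem posSemidef_choiProj {X Y : Type} [Fintype X] [Fintype Y] (A : Matrix Y X ℂ) :
    (choiProj A).PosSemidef :=
  Matrix.posSemidef_vecMulVec_self_star _

theorem isChannelChoi_choiProj {X Y : Type} [Fintype X] [DecidableEq X] [Fintype Y]
    {A : Matrix Y X ℂ} (hA : A.conjTranspose * A = 1) : IsChannelChoi (choiProj A) := by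
  refine (isChannelChoi_iff _).2 ⟨posSemidef_choiProj A, fun x x' => ?_⟩
  have h := congrFun (congrFun hA x') x
  simp only [Matrix.mul_apply, Matrix.one_apply, Matrix.conjTranspose_apply] at h
  simpa [choiProj, choiVec, Matrix.vecMulVec_apply, mul_comm, eq_comm] using h

/-- A multiple of the identity dominates `Kᴴ K`. -/
theorem exists_posSemidef_one_sub {X Y : Type} [Fintype X] [DecidableEq X] [Fintype Y]
    (K : Matrix Y X ℂ) :
    ∃ t : ℝ, 0 < t ∧ (1 - (t : ℂ) • (K.conjTranspose * K)).PosSemidef := by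
  open scoped Matrix.Norms.L2Operator MatrixOrder in
  have hM := (Matrix.posSemidef_conjTranspose_mul_self K).isHermitian
  set M := K.conjTranspose * K with hMdef
  have hle := IsSelfAdjoint.le_algebraMap_norm_self (a := M) hM
  rw [Matrix.le_iff] at hle
  have hn : 0 ≤ ‖M‖ := norm_nonneg M
  set r := ‖M‖
  have h1 : ((1 : Matrix X X ℂ)).PosSemidef := Matrix.PosSemidef.one
  have h2 := hle.add h1
  -- The summand 1 keeps the scale finite when K = 0.
  have ht : 0 < (r + 1)⁻¹ := by positivity
  refine ⟨(r + 1)⁻¹, ht, ?_⟩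
  have h3 := h2.smul (a := (((r + 1)⁻¹ : ℝ) : ℂ)) (by exact_mod_cast ht.le)
  refine (congrArg Matrix.PosSemidef ?_).mpr h3
  have hr : (((r + 1)⁻¹ : ℝ) : ℂ) * ((r : ℂ) + 1) = 1 := by
    rw [Complex.ofReal_inv, Complex.ofReal_add, Complex.ofReal_one]
    refine inv_mul_cancel₀ ?_
    exact_mod_cast (by positivity : r + 1 ≠ 0)
  rw [Algebra.algebraMap_eq_smul_one, ← sub_eq_zero]
  ext i j
  simp only [Matrix.sub_apply, Matrix.smul_apply, Matrix.add_apply, Matrix.zero_apply,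
    smul_eq_mul, Complex.real_smul]
  linear_combination (-(1 : Matrix X X ℂ) i j) * hr

/-- Polarization over ℂ with the vectors e_z + c e_w for c = 0, 1, i; no hermiticity is needed. -/
theorem eq_zero_of_sesquilinear_self_eq_zero {Z : Type} [Fintype Z] [DecidableEq Z]
    (e : Matrix Z Z ℂ) (h : ∀ k : Z → ℂ, ∑ z, ∑ w, e z w * (k z * star (k w)) = 0) : e = 0 := by
  have key : ∀ (z w : Z) (c : ℂ), e z z + c * e w z + star c * e z w + c * star c * e w w = 0 := by
    intro z w c
    rw [← h (fun u => (if u = z then 1 else 0) + (if u = w then c else 0))]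
    simp only [star_add, add_mul, mul_add, Finset.sum_add_distrib]
    simp [apply_ite]
    ring
  ext z w
  have hz := key z z 0
  have hw := key w w 0
  have h1 := key z w 1
  have h2 := key z w Complex.I
  simp at hz hw h1 h2
  rw [hz, hw] at h1 h2
  simp only [Matrix.zero_apply]
  linear_combination (1 / 2 : ℂ) * h1 + (Complex.I / 2) * h2 +
    (e z w - e w z) / 2 * Complex.I_mul_I

theorem posSemidef_single {Y : Type} [Fintype Y] [DecidableEq Y] (y₀ : Y) :
    (Matrix.single y₀ y₀ (1 : ℂ)).PosSemidef := by
  rw [← Matrix.diagonal_single, Matrix.posSemidef_diagonal_iff]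
  intro i
  by_cases hi : i = y₀
  · subst hi; simp
  · simp [hi]

theorem sum_mul_kronecker_single {X Y : Type} [Fintype X] [Fintype Y] [DecidableEq Y]
    (c : X × Y → X × Y → ℂ) (y₀ : Y) (M : Matrix X X ℂ) :
    ∑ z, ∑ w, c z w * (M ⊗ₖ Matrix.single y₀ y₀ (1 : ℂ)) z w =
      ∑ x, ∑ x', c (x, y₀) (x', y₀) * M x x' := by
  have hs : ∀ y y', Matrix.single y₀ y₀ (1 : ℂ) y y' =
      if y = y₀ then if y' = y₀ then 1 else 0 else 0 := by
    intro y y'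
    simp [Matrix.single_apply, ite_and, eq_comm]
  simp only [Fintype.sum_prod_type, Matrix.kronecker_apply, hs, mul_ite, mul_one, mul_zero]
  simp only [Finset.sum_ite_eq', Finset.mem_univ, if_true, Finset.sum_ite_irrel,
    Finset.sum_const_zero]

theorem sum_kronecker_single {X Y : Type} [Fintype Y] [DecidableEq Y]
    (y₀ : Y) (M : Matrix X X ℂ) (x x' : X) :
    ∑ y, (M ⊗ₖ Matrix.single y₀ y₀ (1 : ℂ)) (x, y) (x', y) = M x x' := by
  simp [Matrix.single_apply]

theorem sum_choiProj {X Y : Type} [Fintype Y] (K : Matrix Y X ℂ) (x x' : X) :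
    ∑ y, choiProj K (x, y) (x', y) = (K.conjTranspose * K) x' x := by
  simp [choiProj, choiVec, Matrix.vecMulVec_apply, Matrix.mul_apply, mul_comm]

theorem isChannelChoi_discard {X Y : Type} [Fintype X] [DecidableEq X] [Fintype Y]
    [DecidableEq Y] (y₀ : Y) :
    IsChannelChoi ((1 : Matrix X X ℂ) ⊗ₖ Matrix.single y₀ y₀ (1 : ℂ)) :=
  (isChannelChoi_iff _).2 ⟨Matrix.PosSemidef.one.kronecker (posSemidef_single y₀), fun x x' => by
    rw [sum_kronecker_single, Matrix.one_apply]⟩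

theorem sum_mul_trace_out {X Y : Type} [Fintype X] [Fintype Y] [DecidableEq Y]
    (r : X → X → ℂ) (k : X → Y → X → Y → ℂ) :
    ∑ z : X × Y, ∑ w : X × Y, (if z.2 = w.2 then r z.1 w.1 else 0) * k z.1 z.2 w.1 w.2 =
      ∑ x, ∑ x', r x x' * ∑ y, k x y x' y := by
  simp only [Fintype.sum_prod_type, ite_mul, zero_mul, Finset.sum_ite_eq, Finset.mem_univ, if_true,
    Finset.mul_sum]
  refine Finset.sum_congr rfl fun x _ => ?_
  rw [Finset.sum_comm]

/-- A linear functional which is constant on channels. -/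
theorem functional_const_on_channels {X Y : Type} [Fintype X] [DecidableEq X] [Fintype Y]
    [DecidableEq Y] (c : X × Y → X × Y → ℂ) (κ : ℂ) (y₀ : Y)
    (h : ∀ E : Matrix (X × Y) (X × Y) ℂ, IsChannelChoi E → ∑ z, ∑ w, c z w * E z w = κ) :
    (∀ x x' y y', c (x, y) (x', y') = if y = y' then c (x, y₀) (x', y₀) else 0) ∧
      ∑ x, c (x, y₀) (x, y₀) = κ := by
  have h1 := h _ (isChannelChoi_discard y₀)
  rw [sum_mul_kronecker_single] at h1
  -- The deviation of c from the claimed form vanishes on every |K⟩⟩⟨⟨K|, hence is zero by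
  -- polarization.
  have he : (Matrix.of fun z w => c z w - if z.2 = w.2 then c (z.1, y₀) (w.1, y₀) else 0 :
      Matrix (X × Y) (X × Y) ℂ) = 0 := by
    refine eq_zero_of_sesquilinear_self_eq_zero _ fun k => ?_
    let K : Matrix Y X ℂ := Matrix.of fun y x => k (x, y)
    obtain ⟨t, ht, hpos⟩ := exists_posSemidef_one_sub K
    -- A small multiple of |K⟩⟩⟨⟨K| is completed to a channel by sending the missing weight 1 - t
    -- KᴴK to y₀. Comparison with the channel that discards everything into y₀ isolates the value at
    -- K.
    have hch : IsChannelChoi ((t : ℂ) • choiProj K +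
        (1 - (t : ℂ) • (K.conjTranspose * K)).transpose ⊗ₖ Matrix.single y₀ y₀ (1 : ℂ)) := by
      refine (isChannelChoi_iff _).2 ⟨((posSemidef_choiProj K).smul (by exact_mod_cast ht.le)).add
          (hpos.transpose.kronecker (posSemidef_single y₀)), fun x x' => ?_⟩
      simp only [Matrix.add_apply, Finset.sum_add_distrib, sum_kronecker_single, Matrix.smul_apply,
        ← Finset.smul_sum, sum_choiProj, Matrix.transpose_apply, Matrix.sub_apply]
      simp [Matrix.one_apply, eq_comm]
    have h2 := h _ hch
    simp only [Matrix.add_apply, mul_add, Finset.sum_add_distrib, sum_mul_kronecker_single] at h2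
    have h3 : ∑ z, ∑ w, c z w * choiProj K z w =
        ∑ x, ∑ x', c (x, y₀) (x', y₀) * (K.conjTranspose * K) x' x := by
      have ht' : (t : ℂ) ≠ 0 := by exact_mod_cast ht.ne'
      simp only [Matrix.smul_apply, Matrix.transpose_apply, Matrix.sub_apply, mul_sub,
        Finset.sum_sub_distrib, smul_eq_mul, mul_left_comm _ (t : ℂ), ← Finset.mul_sum] at h2
      simp only [Matrix.one_apply, eq_comm] at h1 h2
      apply mul_left_cancel₀ ht'
      linear_combination h1 - h2
    simp only [Matrix.of_apply, sub_mul, Finset.sum_sub_distrib]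
    rw [sub_eq_zero]
    refine Eq.trans ?_ (h3.trans ?_)
    · rfl
    · have := sum_mul_trace_out (fun x x' => c (x, y₀) (x', y₀))
        (fun x y x' y' => k (x, y) * star (k (x', y')))
      rw [this]
      simp only [Matrix.mul_apply, Matrix.conjTranspose_apply, K, Matrix.of_apply, mul_comm]
  constructor
  · intro x x' y y'
    have := congrFun (congrFun he (x, y)) (x', y')
    simpa [sub_eq_zero] using this
  · simpa [Matrix.one_apply] using h1

/-- A linear functional which vanishes on states. -/
theorem functional_zero_on_states {Y : Type} [Fintype Y]
    [DecidableEq Y] (c : Y → Y → ℂ)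
    (h : ∀ ω : Matrix Y Y ℂ, ω.PosSemidef → ω.trace = 1 → ∑ z, ∑ w, c z w * ω z w = 0) :
    ∀ y y', c y y' = 0 := by
  intro y y'
  -- A state is a channel out of a one-dimensional space; the constant 0 then kills the diagonal
  -- entry as well.
  have h1 := functional_const_on_channels (X := Unit) (fun z w => c z.2 w.2) 0 y (fun E hE => by
    obtain ⟨hpos, htr⟩ := (isChannelChoi_iff E).1 hE
    have h2 := h (E.submatrix (fun y => ((), y)) (fun y => ((), y))) (hpos.submatrix _)
      (by simpa [Matrix.trace] using htr () ())
    simpa [Fintype.sum_prod_type] using h2)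
  have h2 := h1.1 () () y y'
  have h3 : c y y = 0 := by simpa using h1.2
  simpa [h3] using h2


/-! ### One-slot superchannels -/

/-- Trivial ancillas, so that a bare channel can be inserted into a slot. -/
theorem IsChannelChoi.addUnit {X Y : Type} [Fintype X] [DecidableEq X] [Fintype Y]
    {E : Matrix (X × Y) (X × Y) ℂ} (hE : IsChannelChoi E) :
    IsChannelChoi (E.submatrix (fun z : (X × Unit) × (Y × Unit) => (z.1.1, z.2.1))
      (fun z : (X × Unit) × (Y × Unit) => (z.1.1, z.2.1))) := by
  obtain ⟨hpos, htr⟩ := (isChannelChoi_iff E).1 hE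
  refine (isChannelChoi_iff _).2 ⟨hpos.submatrix _, ?_⟩
  rintro ⟨x, ⟨⟩⟩ ⟨x', ⟨⟩⟩
  simpa [Fintype.sum_prod_type] using htr x x'

section OneSlot

variable {P AI AO F : Type}
  [Fintype P] [DecidableEq P] [Fintype AI] [DecidableEq AI] [Fintype AO] [DecidableEq AO]
  [Fintype F] [DecidableEq F]

theorem slotLink₁_apply {AI' AO' : Type} [Fintype AI'] [DecidableEq AI'] [Fintype AO']
    [DecidableEq AO'] (W : Matrix ((P × AO) × (AI × F)) ((P × AO) × (AI × F)) ℂ)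
    (E : Matrix ((AI × AI') × (AO × AO')) ((AI × AI') × (AO × AO')) ℂ)
    (p p' : P) (f f' : F) (x x' : AI') (y y' : AO') :
    slotLink₁ W E ((p, x), (f, y)) ((p', x'), (f', y')) =
      ∑ z : AI × AO, ∑ w : AI × AO,
        W ((p, z.2), (z.1, f)) ((p', w.2), (w.1, f')) *
          E ((z.1, x), (z.2, y)) ((w.1, x'), (w.2, y')) := by
  simp only [slotLink₁, Matrix.submatrix_apply, linkProduct_apply]

theorem slotLink₁_posSemidef {AI' AO' : Type} [Fintype AI'] [DecidableEq AI'] [Fintype AO']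
    [DecidableEq AO'] {W : Matrix ((P × AO) × (AI × F)) ((P × AO) × (AI × F)) ℂ}
    {E : Matrix ((AI × AI') × (AO × AO')) ((AI × AI') × (AO × AO')) ℂ}
    (hW : W.PosSemidef) (hE : E.PosSemidef) : (slotLink₁ W E).PosSemidef :=
  (linkProduct_posSemidef (hW.submatrix _) (hE.submatrix _)).submatrix _

theorem sum_slotLink₁ {AI' AO' : Type} [Fintype AI'] [DecidableEq AI'] [Fintype AO']
    [DecidableEq AO'] (W : Matrix ((P × AO) × (AI × F)) ((P × AO) × (AI × F)) ℂ)
    (E : Matrix ((AI × AI') × (AO × AO')) ((AI × AI') × (AO × AO')) ℂ)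
    (p p' : P) (x x' : AI') :
    ∑ u : F × AO', slotLink₁ W E ((p, x), u) ((p', x'), u) =
      ∑ z : AI × AO, ∑ w : AI × AO,
        (∑ f, W ((p, z.2), (z.1, f)) ((p', w.2), (w.1, f))) *
          ∑ y, E ((z.1, x), (z.2, y)) ((w.1, x'), (w.2, y)) := by
  simp only [Fintype.sum_prod_type (α₁ := F), slotLink₁_apply, Finset.sum_mul_sum]
  simp only [Finset.sum_comm (s := (Finset.univ : Finset AO'))
      (t := (Finset.univ : Finset (AI × AO))),
    Finset.sum_comm (s := (Finset.univ : Finset F)) (t := (Finset.univ : Finset (AI × AO)))]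

/-- Necessity of the linear conditions is `functional_const_on_channels` applied to Tr_F W. For
sufficiency, these conditions let the traces over `AO` and then `AI` be closed one after the other.
-/
theorem isSuperchannel₁_iff (o₀ : AO)
    (W : Matrix ((P × AO) × (AI × F)) ((P × AO) × (AI × F)) ℂ) :
    IsSuperchannel₁ W ↔ W.PosSemidef ∧
      (∀ p p' o o' i i', ∑ f, W ((p, o), (i, f)) ((p', o'), (i', f)) =
        if o = o' then ∑ f, W ((p, o₀), (i, f)) ((p', o₀), (i', f)) else 0) ∧
      ∀ p p', ∑ i, ∑ f, W ((p, o₀), (i, f)) ((p', o₀), (i, f)) = if p = p' then 1 else 0 := by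
  constructor
  · intro h
    refine ⟨?_, ?_⟩
    -- The swap, with ancillas AI' = AO and AO' = AI: inserting it returns W itself up to
    -- reordering, so W inherits positivity.
    · let A : Matrix (AO × AI) (AI × AO) ℂ := Matrix.of fun u v =>
        if u.1 = v.2 then if u.2 = v.1 then 1 else 0 else 0
      have hA : A.conjTranspose * A = 1 := by
        ext ⟨a, b⟩ ⟨a', b'⟩
        by_cases h1 : a = a' <;> by_cases h2 : b = b' <;>
        simp [A, Matrix.mul_apply, Fintype.sum_prod_type, Matrix.one_apply, h1, h2, eq_comm]
      have h1 := ((isChannelChoi_iff _).1 (h AO AI _ (isChannelChoi_choiProj hA))).1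
      refine (congrArg Matrix.PosSemidef ?_).mpr
        (h1.submatrix (fun z : (P × AO) × (AI × F) => ((z.1.1, z.1.2), (z.2.2, z.2.1))))
      ext ⟨⟨p, o⟩, ⟨i, f⟩⟩ ⟨⟨p', o'⟩, ⟨i', f'⟩⟩
      rw [Matrix.submatrix_apply, slotLink₁_apply]
      simp [choiProj, choiVec, Matrix.vecMulVec_apply, A, Fintype.sum_prod_type, apply_ite]
    · have hc : ∀ p p', _ := fun p p' => functional_const_on_channels (X := AI) (Y := AO)
        (fun z w => ∑ f, W ((p, z.2), (z.1, f)) ((p', w.2), (w.1, f)))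
        (if p = p' then 1 else 0) o₀ (fun E hE => by
          have h2 := ((isChannelChoi_iff _).1 (h Unit Unit _ hE.addUnit)).2 (p, ()) (p', ())
          rw [sum_slotLink₁] at h2
          simpa using h2)
      exact ⟨fun p p' o o' i i' => (hc p p').1 i i' o o', fun p p' => (hc p p').2⟩
  · rintro ⟨hpos, h1, h2⟩ AI' AO' _ _ _ _ E hE
    obtain ⟨hEpos, hEtr⟩ := (isChannelChoi_iff _).1 hE
    refine (isChannelChoi_iff _).2 ⟨slotLink₁_posSemidef hpos hEpos, ?_⟩
    rintro ⟨p, x⟩ ⟨p', x'⟩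
    rw [sum_slotLink₁]
    refine (Finset.sum_congr rfl fun z _ => Finset.sum_congr rfl fun w _ =>
      congrArg (· * _) (h1 p p' z.2 w.2 z.1 w.1)).trans ?_
    rw [sum_mul_trace_out (fun i i' => ∑ f, W ((p, o₀), (i, f)) ((p', o₀), (i', f)))
      (fun i o i' o' => ∑ y, E ((i, x), (o, y)) ((i', x'), (o', y)))]
    have h3 : ∀ i i', ∑ o, ∑ y, E ((i, x), (o, y)) ((i', x'), (o, y)) =
        if i = i' then if x = x' then 1 else 0 else 0 := by
      intro i i'
      have := hEtr (i, x) (i', x')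
      rw [Fintype.sum_prod_type] at this
      simpa [ite_and] using this
    simp only [h3, mul_ite, mul_zero, mul_one, Finset.sum_ite_eq, Finset.mem_univ, if_true]
    by_cases hx : x = x'
    · simp [hx, h2]
    · simp [hx]

end OneSlot


/-! ### Causality conditions on unitary operators -/

section TwoSlots

variable {P AI AO BI BO F : Type}
  [Fintype P] [DecidableEq P] [Fintype AI] [DecidableEq AI] [Fintype AO] [DecidableEq AO]
  [Fintype BI] [DecidableEq BI] [Fintype BO] [DecidableEq BO] [Fintype F] [DecidableEq F]

/-- The blocks on `P` of `Uᴴ (|i⟩⟨j| ⊗ |k⟩⟨l| ⊗ 1) U`. -/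
def heis (U : Matrix (AI × BI × F) (P × AO × BO) ℂ) (i j : AI) (k l : BI) (a a' : AO)
    (b b' : BO) : Matrix P P ℂ :=
  Matrix.of fun p p' => ∑ f, star (U (i, k, f) (p, a, b)) * U (j, l, f) (p', a', b')

/-- Exchange of the two slots. -/
def swapOp (U : Matrix (AI × BI × F) (P × AO × BO) ℂ) : Matrix (BI × AI × F) (P × BO × AO) ℂ :=
  U.submatrix (fun z => (z.2.1, z.1, z.2.2)) (fun z => (z.1, z.2.2, z.2.1))

theorem heis_swapOp (U : Matrix (AI × BI × F) (P × AO × BO) ℂ) (i j : AI) (k l : BI) (a a' : AO)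
    (b b' : BO) : heis (swapOp U) k l i j b b' a a' = heis U i j k l a a' b b' := rfl

/-- `AI` does not depend on `AO`. -/
def NoSignalA (U : Matrix (AI × BI × F) (P × AO × BO) ℂ) : Prop :=
  ∀ i j a a' a₀ b b', ∑ k, heis U i j k k a a' b b' =
    if a = a' then ∑ k, heis U i j k k a₀ a₀ b b' else 0

/-- There is no loop `AO → BI → BO → AI → AO`. -/
def NoLoop (U : Matrix (AI × BI × F) (P × AO × BO) ℂ) : Prop :=
  ∀ i j k l a a' a₀ b b' b₀,
    heis U i j k l a a' b b' - (if a = a' then heis U i j k l a₀ a₀ b b' else 0) =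
      if b = b' then heis U i j k l a a' b₀ b₀ - (if a = a' then heis U i j k l a₀ a₀ b₀ b₀ else 0)
      else 0

/-- The causality conditions which characterize two-slot superchannels. -/
structure Admissible (U : Matrix (AI × BI × F) (P × AO × BO) ℂ) : Prop where
  noSignalA : NoSignalA U
  noSignalB : NoSignalA (swapOp U)
  noLoop : NoLoop U

theorem NoLoop.swap {U : Matrix (AI × BI × F) (P × AO × BO) ℂ} (h : NoLoop U) :
    NoLoop (swapOp U) := by
  intro k l i j b b' b₀ a a' a₀
  simp only [heis_swapOp]
  have := h i j k l a a' a₀ b b' b₀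
  by_cases ha : a = a' <;> by_cases hb : b = b' <;> simp [ha, hb] at this ⊢
  · exact sub_eq_sub_iff_sub_eq_sub.1 this
  · rwa [sub_eq_zero] at this
  · rwa [sub_eq_zero]
  · exact this

theorem Admissible.swap {U : Matrix (AI × BI × F) (P × AO × BO) ℂ} (h : Admissible U) :
    Admissible (swapOp U) :=
  ⟨h.noSignalB, h.noSignalA, h.noLoop.swap⟩

/-- The second index of `choiProj` carries the complex conjugate, which is why the arguments of
`heis` appear exchanged. -/
theorem sum_slotLink₂ (U : Matrix (AI × BI × F) (P × AO × BO) ℂ)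
    (EA : Matrix (AI × AO) (AI × AO) ℂ) (EB : Matrix (BI × BO) (BI × BO) ℂ) (p p' : P) :
    ∑ x : F × Unit × Unit, slotLink₂ (AI' := Unit) (AO' := Unit) (BI' := Unit) (BO' := Unit)
        (choiProj U)
        (EA.submatrix (fun z => (z.1.1, z.2.1)) (fun z => (z.1.1, z.2.1)))
        (EB.submatrix (fun z => (z.1.1, z.2.1)) (fun z => (z.1.1, z.2.1)))
        ((p, (), ()), x) ((p', (), ()), x) =
      ∑ z, ∑ w, (∑ u, ∑ v, heis U w.1 z.1 v.1 u.1 w.2 z.2 v.2 u.2 p' p * EB u v) * EA z w := by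
  simp only [slotLink₂, Matrix.submatrix_apply, linkProduct_apply, Matrix.kronecker_apply,
    Fintype.sum_prod_type, choiProj, Matrix.vecMulVec_apply, choiVec, heis, Matrix.of_apply,
    Finset.sum_mul, Pi.star_apply, Finset.univ_unique, Finset.sum_singleton]
  simp only [Finset.sum_comm (s := (Finset.univ : Finset F)) (t := (Finset.univ : Finset AI)),
    Finset.sum_comm (s := (Finset.univ : Finset F)) (t := (Finset.univ : Finset AO)),
    Finset.sum_comm (s := (Finset.univ : Finset F)) (t := (Finset.univ : Finset BI)),
    Finset.sum_comm (s := (Finset.univ : Finset F)) (t := (Finset.univ : Finset BO)),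
    Finset.sum_comm (s := (Finset.univ : Finset BO)) (t := (Finset.univ : Finset AI)),
    Finset.sum_comm (s := (Finset.univ : Finset BO)) (t := (Finset.univ : Finset AO)),
    Finset.sum_comm (s := (Finset.univ : Finset BI)) (t := (Finset.univ : Finset AI)),
    Finset.sum_comm (s := (Finset.univ : Finset BI)) (t := (Finset.univ : Finset AO))]
  refine Finset.sum_congr rfl fun i _ => Finset.sum_congr rfl fun a _ =>
    Finset.sum_congr rfl fun j _ => Finset.sum_congr rfl fun a' _ =>
    Finset.sum_congr rfl fun k _ => Finset.sum_congr rfl fun b _ =>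
    Finset.sum_congr rfl fun l _ => Finset.sum_congr rfl fun b' _ =>
    Finset.sum_congr rfl fun f _ => ?_
  ring

theorem IsSuperchannel₂.channel_sum {U : Matrix (AI × BI × F) (P × AO × BO) ℂ}
    (hU : IsSuperchannel₂ (choiProj U)) {EA : Matrix (AI × AO) (AI × AO) ℂ}
    {EB : Matrix (BI × BO) (BI × BO) ℂ} (hA : IsChannelChoi EA) (hB : IsChannelChoi EB)
    (p p' : P) :
    ∑ z, ∑ w, (∑ u, ∑ v, heis U w.1 z.1 v.1 u.1 w.2 z.2 v.2 u.2 p' p * EB u v) * EA z w =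
      if p = p' then 1 else 0 := by
  have h := ((isChannelChoi_iff _).1 (hU _ _ _ _ _ _ hA.addUnit hB.addUnit)).2
    (p, (), ()) (p', (), ())
  rw [sum_slotLink₂] at h
  simpa using h

/-- Two rounds of `functional_const_on_channels`. Constancy in EA makes the deviation from
independence of `AO` a functional of EB that vanishes on all channels. A second application gives
the no-loop condition from the shape of this functional and no-signalling from its constant 0. -/
theorem noLoop_of_channel_sum {U : Matrix (AI × BI × F) (P × AO × BO) ℂ}
    (hU : ∀ (EA : Matrix (AI × AO) (AI × AO) ℂ) (EB : Matrix (BI × BO) (BI × BO) ℂ),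
      IsChannelChoi EA → IsChannelChoi EB → ∀ p p' : P,
      ∑ z, ∑ w, (∑ u, ∑ v, heis U w.1 z.1 v.1 u.1 w.2 z.2 v.2 u.2 p' p * EB u v) * EA z w =
        if p = p' then 1 else 0) : NoLoop U ∧ NoSignalA U := by
  have key : ∀ p p' i j a a' a₀, ∀ b₀ : BO, _ := fun p p' i j a a' a₀ b₀ =>
    functional_const_on_channels (X := BI) (Y := BO)
      (fun u v => heis U j i v.1 u.1 a' a v.2 u.2 p' p -
        if a = a' then heis U j i v.1 u.1 a₀ a₀ v.2 u.2 p' p else 0) 0 b₀ (fun EB hB => by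
      have h := (functional_const_on_channels
        (fun z w : AI × AO => ∑ u, ∑ v, heis U w.1 z.1 v.1 u.1 w.2 z.2 v.2 u.2 p' p * EB u v)
        _ a₀ (fun EA hA => hU EA EB hA hB p p')).1 i j a a'
      simp only [sub_mul, Finset.sum_sub_distrib]
      rw [sub_eq_zero]
      refine h.trans ?_
      by_cases ha : a = a' <;> simp [ha])
  constructor
  · intro i j k l a a' a₀ b b' b₀
    ext p p'
    have h := (key p' p j i a' a a₀ b₀).1 l k b' b
    simp only [eq_comm (a := a'), eq_comm (a := b')] at h
    by_cases ha : a = a' <;> by_cases hb : b = b' <;> simpa [ha, hb] using h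
  · intro i j a a' a₀ b b'
    ext p p'
    have h1 := fun k => (key p' p j i a' a a₀ b).1 k k b' b
    have h2 := (key p' p j i a' a a₀ b).2
    have h3 := Finset.sum_congr rfl fun k (_ : k ∈ Finset.univ) => h1 k
    simp only [Finset.sum_ite_irrel, Finset.sum_const_zero, h2, ite_self] at h3
    rw [Finset.sum_sub_distrib, sub_eq_zero] at h3
    by_cases ha : a = a'
    · simpa [ha, Matrix.sum_apply] using h3
    · simpa [ha, Ne.symm ha, Matrix.sum_apply] using h3

/-! ### Ordered operators -/

/-- `BI` and `AI` do not depend on `BO`, and `AI` does not depend on `AO`. -/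
structure OrderedAB (U : Matrix (AI × BI × F) (P × AO × BO) ℂ) : Prop where
  first : ∀ i j k l a a' b b' b₀,
    heis U i j k l a a' b b' = if b = b' then heis U i j k l a a' b₀ b₀ else 0
  second : NoSignalA U

theorem combLink_apply {AI' BO' : Type} [Fintype AI'] [DecidableEq AI'] [Fintype BO']
    [DecidableEq BO']
    (R : Matrix ((P × AO × BO) × (AI × BI × F)) ((P × AO × BO) × (AI × BI × F)) ℂ)
    (S : Matrix (((AI × AI') × BI) × (AO × (BO × BO'))) (((AI × AI') × BI) × (AO × (BO × BO'))) ℂ)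
    (p p' : P) (x x' : AI') (f f' : F) (y y' : BO') :
    combLink R S ((p, x), (f, y)) ((p', x'), (f', y')) =
      ∑ z : AI × AO × BI × BO, ∑ w : AI × AO × BI × BO,
        R ((p, z.2.1, z.2.2.2), (z.1, z.2.2.1, f)) ((p', w.2.1, w.2.2.2), (w.1, w.2.2.1, f')) *
        S (((z.1, x), z.2.2.1), (z.2.1, (z.2.2.2, y)))
          (((w.1, x'), w.2.2.1), (w.2.1, (w.2.2.2, y'))) := by
  simp only [combLink, Matrix.submatrix_apply, linkProduct_apply]

theorem sum_combLink {AI' BO' : Type} [Fintype AI'] [DecidableEq AI'] [Fintype BO']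
    [DecidableEq BO'] (U : Matrix (AI × BI × F) (P × AO × BO) ℂ)
    (S : Matrix (((AI × AI') × BI) × (AO × (BO × BO'))) (((AI × AI') × BI) × (AO × (BO × BO'))) ℂ)
    (p p' : P) (x x' : AI') :
    ∑ u : F × BO', combLink (choiProj U) S ((p, x), u) ((p', x'), u) =
      ∑ z : AI × AO × BI × BO, ∑ w : AI × AO × BI × BO,
        heis U w.1 z.1 w.2.2.1 z.2.2.1 w.2.1 z.2.1 w.2.2.2 z.2.2.2 p' p *
        ∑ y, S (((z.1, x), z.2.2.1), (z.2.1, (z.2.2.2, y)))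
          (((w.1, x'), w.2.2.1), (w.2.1, (w.2.2.2, y))) := by
  simp only [Fintype.sum_prod_type (α₁ := F), combLink_apply, choiProj, Matrix.vecMulVec_apply,
    choiVec, heis, Matrix.of_apply, Finset.sum_mul_sum, Pi.star_apply,
    mul_comm (U _ _) (star (U _ _))]
  simp only [Finset.sum_comm (s := (Finset.univ : Finset BO'))
      (t := (Finset.univ : Finset (AI × AO × BI × BO))),
    Finset.sum_comm (s := (Finset.univ : Finset F))
      (t := (Finset.univ : Finset (AI × AO × BI × BO)))]

theorem combLink_posSemidef {AI' BO' : Type} [Fintype AI'] [DecidableEq AI'] [Fintype BO']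
    [DecidableEq BO']
    {R : Matrix ((P × AO × BO) × (AI × BI × F)) ((P × AO × BO) × (AI × BI × F)) ℂ}
    {S : Matrix (((AI × AI') × BI) × (AO × (BO × BO'))) (((AI × AI') × BI) × (AO × (BO × BO'))) ℂ}
    (hR : R.PosSemidef) (hS : S.PosSemidef) : (combLink R S).PosSemidef :=
  (linkProduct_posSemidef (hR.submatrix _) (hS.submatrix _)).submatrix _

theorem sum_assoc₄ {M : Type} [AddCommMonoid M] (f : AI × AO × BI × BO → M) :
    ∑ z, f z = ∑ z : ((AI × AO) × BI) × BO, f (z.1.1.1, z.1.1.2, z.1.2, z.2) := by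
  simp only [Fintype.sum_prod_type]

/-- Operators with ordered causality conditions are combs. -/
theorem OrderedAB.representsCombAB [Nonempty AO] [Nonempty BI] [Nonempty BO]
    {U : Matrix (AI × BI × F) (P × AO × BO) ℂ} (h : OrderedAB U) (hU : IsUnitaryOp U) :
    RepresentsCombAB U := by
  refine ⟨hU, fun AI' BO' _ _ _ _ S hS => ?_⟩
  obtain ⟨a₀⟩ := ‹Nonempty AO›
  obtain ⟨k₀⟩ := ‹Nonempty BI›
  obtain ⟨b₀⟩ := ‹Nonempty BO›
  obtain ⟨hpos, hS1, hS2⟩ := (isSuperchannel₁_iff k₀ S).1 hS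
  refine (isChannelChoi_iff _).2 ⟨combLink_posSemidef (posSemidef_choiProj U) hpos, ?_⟩
  rintro ⟨p, x⟩ ⟨p', x'⟩
  rw [sum_combLink]
  simp only [sum_assoc₄]
  -- The traces over `BO`, `BI`, `AO`, `AI` are closed in this order, using the causality of U and
  -- of S in turn (`e1` to `e4`); unitarity of U gives the final normalisation `e5`.
  have e1 : ∀ z w : ((AI × AO) × BI) × BO,
      heis U w.1.1.1 z.1.1.1 w.1.2 z.1.2 w.1.1.2 z.1.1.2 w.2 z.2 p' p =
        if z.2 = w.2 then heis U w.1.1.1 z.1.1.1 w.1.2 z.1.2 w.1.1.2 z.1.1.2 b₀ b₀ p' p else 0 := by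
    intro z w
    rw [h.first _ _ _ _ _ _ _ _ b₀]
    by_cases hz : z.2 = w.2
    · simp [hz]
    · simp [hz, Ne.symm hz]
  refine (Finset.sum_congr rfl fun z _ => Finset.sum_congr rfl fun w _ =>
      congrArg (· * _) (e1 z w)).trans ?_
  rw [sum_mul_trace_out (fun z w : (AI × AO) × BI =>
    heis U w.1.1 z.1.1 w.2 z.2 w.1.2 z.1.2 b₀ b₀ p' p)
    (fun z b w b' => ∑ y, S (((z.1.1, x), z.2), (z.1.2, (b, y)))
          (((w.1.1, x'), w.2), (w.1.2, (b', y))))]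
  have e2 : ∀ z w : (AI × AO) × BI, ∑ b, ∑ y, S (((z.1.1, x), z.2), (z.1.2, (b, y)))
          (((w.1.1, x'), w.2), (w.1.2, (b, y))) =
        if z.2 = w.2 then ∑ f, S (((z.1.1, x), k₀), (z.1.2, f))
          (((w.1.1, x'), k₀), (w.1.2, f)) else 0 := by
    intro z w
    rw [← hS1, Fintype.sum_prod_type]
  refine (Finset.sum_congr rfl fun z _ => Finset.sum_congr rfl fun w _ =>
      (congrArg (_ * ·) (e2 z w)).trans (mul_comm _ _)).trans ?_
  rw [sum_mul_trace_out (fun z w : AI × AO => ∑ f, S (((z.1, x), k₀), (z.2, f))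
          (((w.1, x'), k₀), (w.2, f)))
    (fun z k w l => heis U w.1 z.1 l k w.2 z.2 b₀ b₀ p' p)]
  have e3 : ∀ z w : AI × AO, ∑ k, heis U w.1 z.1 k k w.2 z.2 b₀ b₀ p' p =
      if z.2 = w.2 then ∑ k, heis U w.1 z.1 k k a₀ a₀ b₀ b₀ p' p else 0 := by
    intro z w
    have := congrFun (congrFun (h.second w.1 z.1 w.2 z.2 a₀ b₀ b₀) p') p
    rw [Matrix.sum_apply] at this
    rw [this]
    by_cases hz : z.2 = w.2
    · simp [hz, Matrix.sum_apply]
    · simp [hz, Ne.symm hz]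
  refine (Finset.sum_congr rfl fun z _ => Finset.sum_congr rfl fun w _ =>
      (congrArg (_ * ·) (e3 z w)).trans (mul_comm _ _)).trans ?_
  rw [sum_mul_trace_out (fun i j : AI => ∑ k, heis U j i k k a₀ a₀ b₀ b₀ p' p)
    (fun i a j a' => ∑ f, S (((i, x), k₀), (a, f)) (((j, x'), k₀), (a', f)))]
  have e4 : ∀ i j : AI, ∑ a, ∑ f, S (((i, x), k₀), (a, f)) (((j, x'), k₀), (a, f)) =
      if i = j then if x = x' then 1 else 0 else 0 := by
    intro i j
    rw [hS2]
    simp [ite_and]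
  simp only [e4, mul_ite, mul_zero, mul_one, Finset.sum_ite_eq, Finset.mem_univ, if_true]
  have e5 := congrFun (congrFun hU.1 (p', a₀, b₀)) (p, a₀, b₀)
  rw [Matrix.mul_apply] at e5
  simp only [Fintype.sum_prod_type, Matrix.conjTranspose_apply, Matrix.one_apply] at e5
  by_cases hx : x = x'
  · simpa [hx, heis, eq_comm] using e5
  · simp [hx]

/-- Here s is the trace of S over `BO`, and `h1`, `h2` are the criterion `isSuperchannel₁_iff` for S
with trivial ancillas. Concrete test combs can thus be inserted without unfolding the definition. -/
theorem comb_channel_sum {U : Matrix (AI × BI × F) (P × AO × BO) ℂ} [Nonempty BI]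
    (hU : IsCombAB (choiProj U))
    (S : AI × AO × BI × BO → AI × AO × BI × BO → ℂ) (hpos : (Matrix.of S).PosSemidef)
    (s : AI → AI → AO → AO → ℂ)
    (h1 : ∀ i j a a' k l, ∑ b, S (i, a, k, b) (j, a', l, b) = if k = l then s i j a a' else 0)
    (h2 : ∀ i j, ∑ a, s i j a a = if i = j then 1 else 0) (p p' : P) :
    ∑ z : AI × AO × BI × BO, ∑ w : AI × AO × BI × BO,
        heis U w.1 z.1 w.2.2.1 z.2.2.1 w.2.1 z.2.1 w.2.2.2 z.2.2.2 p' p * S z w =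
      if p = p' then 1 else 0 := by
  obtain ⟨k₀⟩ := ‹Nonempty BI›
  let g : (((AI × Unit) × BI) × (AO × (BO × Unit))) → AI × AO × BI × BO :=
    fun z => (z.1.1.1, z.2.1, z.1.2, z.2.2.1)
  have hS : IsSuperchannel₁ ((Matrix.of S).submatrix g g) := by
    refine (isSuperchannel₁_iff k₀ _).2 ⟨hpos.submatrix g, ?_, ?_⟩
    · intro p p' k l a a'
      simp [g, Fintype.sum_prod_type, h1]
    · intro p p'
      have : p = p' ↔ p.1 = p'.1 := by
        constructor
        · rintro rfl; rfl
        · intro h; exact Prod.ext h rfl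
      simp [g, Fintype.sum_prod_type, h1, h2, this]
  have h := ((isChannelChoi_iff _).1 (hU Unit Unit _ hS)).2 (p, ()) (p', ())
  rw [sum_combLink] at h
  simpa [g] using h

/-- The test combs feed a state ω into `AO` and end with a channel E from AI ⊗ BI to BO. Varying E
gives independence of `BO` for each ω; varying ω frees the indices of `AO`. -/
theorem IsCombAB.first [Nonempty BI] {U : Matrix (AI × BI × F) (P × AO × BO) ℂ}
    (hU : IsCombAB (choiProj U)) (i j : AI) (k l : BI) (a a' : AO) (b b' b₀ : BO) :
    heis U i j k l a a' b b' = if b = b' then heis U i j k l a a' b₀ b₀ else 0 := by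
  ext p' p
  have key : ∀ a a', heis U i j k l a' a b b' p' p -
      (if b = b' then heis U i j k l a' a b₀ b₀ p' p else 0) = 0 :=
    functional_zero_on_states _ (fun ω hω htr => by
      have h := (functional_const_on_channels (X := AI × BI) (Y := BO)
        (fun z w => ∑ a, ∑ a', heis U w.1.1 z.1.1 w.1.2 z.1.2 a' a w.2 z.2 p' p * ω a a')
        (if p = p' then 1 else 0) b₀ (fun E hE => by
          obtain ⟨hpos, hEtr⟩ := (isChannelChoi_iff _).1 hE
          rw [← comb_channel_sum hU (fun z w => E ((z.1, z.2.2.1), z.2.2.2)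
            ((w.1, w.2.2.1), w.2.2.2) * ω z.2.1 w.2.1)
            ((hpos.kronecker hω).submatrix
              (fun z : AI × AO × BI × BO => (((z.1, z.2.2.1), z.2.2.2), z.2.1)))
            (fun i j a a' => if i = j then ω a a' else 0) ?_ ?_ p p']
          · simp only [Fintype.sum_prod_type, Finset.sum_mul]
            simp only [Finset.sum_comm (s := (Finset.univ : Finset AO))
                (t := (Finset.univ : Finset AI)),
              Finset.sum_comm (s := (Finset.univ : Finset AO)) (t := (Finset.univ : Finset BI)),
              Finset.sum_comm (s := (Finset.univ : Finset AO)) (t := (Finset.univ : Finset BO))]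
            simp only [mul_assoc, mul_comm (ω _ _)]
          · intro i j a a' k l
            simp only [← Finset.sum_mul, hEtr]
            by_cases hi : i = j <;> by_cases hk : k = l <;> simp [hi, hk]
          · intro i j
            by_cases hi : i = j
            · simpa [hi, Matrix.trace] using htr
            · simp [hi])).1 (j, l) (i, k) b' b
      simp only [sub_mul, Finset.sum_sub_distrib]
      rw [sub_eq_zero]
      refine h.trans ?_
      by_cases hb : b = b'
      · simp [hb]
      · simp [hb, Ne.symm hb])
  rw [sub_eq_zero.1 (key a' a)]
  by_cases hb : b = b' <;> simp [hb]

/-- For the second condition the test combs apply a channel from `AI` to `AO`, then discard `BI` and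
prepare a basis state on `BO`. Blocks off-diagonal in `BO` already vanish by `IsCombAB.first`. -/
theorem IsCombAB.orderedAB [Nonempty BI] {U : Matrix (AI × BI × F) (P × AO × BO) ℂ}
    (hU : IsCombAB (choiProj U)) : OrderedAB U := by
  refine ⟨hU.first, fun i j a a' a₀ b b' => ?_⟩
  have key : ∀ p p', (∑ k, heis U i j k k a a' b b p' p) =
      if a' = a then ∑ k, heis U i j k k a₀ a₀ b b p' p else 0 := fun p p' =>
    (functional_const_on_channels (X := AI) (Y := AO)
      (fun z w => ∑ k, heis U w.1 z.1 k k w.2 z.2 b b p' p)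
      (if p = p' then 1 else 0) a₀ (fun E hE => by
        obtain ⟨hpos, hEtr⟩ := (isChannelChoi_iff _).1 hE
        obtain ⟨hpos', hEtr'⟩ := (isChannelChoi_iff _).1 (isChannelChoi_discard (X := BI) b)
        rw [← comb_channel_sum hU (fun z w => E (z.1, z.2.1) (w.1, w.2.1) *
          ((1 : Matrix BI BI ℂ) ⊗ₖ Matrix.single b b (1 : ℂ)) z.2.2 w.2.2)
          ((hpos.kronecker hpos').submatrix
            (fun z : AI × AO × BI × BO => ((z.1, z.2.1), z.2.2)))
          (fun i j a a' => E (i, a) (j, a')) ?_ hEtr p p']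
        · have e : ∀ f : (AI × AO × BI × BO) → ℂ, ∑ z, f z =
            ∑ z : AI × AO, ∑ u : BI × BO, f (z.1, z.2, u) := fun f => by
              simp only [Fintype.sum_prod_type]
          rw [e]
          refine Finset.sum_congr rfl fun z _ => ?_
          simp only [e]
          rw [Finset.sum_comm]
          refine Finset.sum_congr rfl fun w _ => ?_
          have := sum_mul_kronecker_single (fun u v : BI × BO =>
            heis U w.1 z.1 v.1 u.1 w.2 z.2 v.2 u.2 p' p) b 1
          simp only [Matrix.one_apply, mul_ite, mul_one, mul_zero, Finset.sum_ite_eq,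
            Finset.mem_univ, if_true] at this
          rw [← this, Finset.sum_mul]
          simp only [Finset.sum_mul, mul_assoc, mul_comm (E _ _)]
        · intro i j a a' k l
          simp only [← Finset.mul_sum, hEtr']
          by_cases hk : k = l <;> simp [hk])).1 j i a' a
  by_cases hb : b = b'
  · subst hb
    ext p' p
    rw [Matrix.sum_apply, key]
    by_cases ha : a = a'
    · simp [ha, Matrix.sum_apply]
    · simp [ha, Ne.symm ha]
  · have e : ∀ k a a', heis U i j k k a a' b b' = 0 := fun k a a' => by
      rw [hU.first _ _ _ _ _ _ _ _ b, if_neg hb]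
    simp [e]

/-! ### Causality conditions under changes of basis and direct sums -/

/-- The blocks `P → F` of an operator. -/
def blockOp (U : Matrix (AI × BI × F) (P × AO × BO) ℂ) (i : AI) (k : BI) (a : AO) (b : BO) :
    Matrix F P ℂ :=
  Matrix.of fun f p => U (i, k, f) (p, a, b)

theorem heis_eq_blockOp (U : Matrix (AI × BI × F) (P × AO × BO) ℂ) (i j : AI) (k l : BI)
    (a a' : AO) (b b' : BO) :
    heis U i j k l a a' b b' = (blockOp U i k a b).conjTranspose * blockOp U j l a' b' := by
  ext p p'
  simp [heis, blockOp, Matrix.mul_apply]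

theorem changeBasis_apply {Q G : Type} [Fintype Q] [Fintype G] (S : Matrix P Q ℂ) (T : Matrix F G ℂ)
    (U : Matrix (AI × BI × F) (P × AO × BO) ℂ) (i : AI) (k : BI) (g : G) (q : Q) (a : AO) (b : BO) :
    changeBasis S T U (i, k, g) (q, a, b) = ∑ f, star (T f g) * ∑ p, U (i, k, f) (p, a, b) * S p q := by
  simp only [changeBasis, Matrix.mul_apply, Fintype.sum_prod_type, Matrix.kronecker_apply,
    Matrix.one_apply, Matrix.conjTranspose_apply, ite_mul, one_mul, zero_mul, mul_ite, mul_one,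
    mul_zero, Finset.sum_ite_irrel, Finset.sum_const_zero, Finset.sum_ite_eq, Finset.sum_ite_eq',
    Finset.mem_univ, if_true, Finset.sum_mul, Finset.mul_sum]
  rw [Finset.sum_comm]
  simp only [mul_assoc]

theorem blockOp_changeBasis {Q G : Type} [Fintype Q] [Fintype G] (S : Matrix P Q ℂ)
    (T : Matrix F G ℂ) (U : Matrix (AI × BI × F) (P × AO × BO) ℂ) (i : AI) (k : BI)
    (a : AO) (b : BO) :
    blockOp (changeBasis S T U) i k a b = T.conjTranspose * (blockOp U i k a b * S) := by
  ext g q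
  simp only [blockOp, Matrix.of_apply, changeBasis_apply, Matrix.mul_apply,
    Matrix.conjTranspose_apply]

/-- `heis` sees `F` only through the identity operator, so T cancels and S acts by conjugation. -/
theorem heis_eq_of_changeBasis {Q G : Type} [Fintype Q] [DecidableEq Q] [Fintype G] [DecidableEq G]
    {S : Matrix P Q ℂ} {T : Matrix F G ℂ} (hS : IsUnitaryOp S) (hT : IsUnitaryOp T)
    (U : Matrix (AI × BI × F) (P × AO × BO) ℂ) (i j : AI) (k l : BI) (a a' : AO) (b b' : BO) :
    heis U i j k l a a' b b' =
      S * heis (changeBasis S T U) i j k l a a' b b' * S.conjTranspose := by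
  have e : ∀ A B : Matrix F P ℂ, S * ((T.conjTranspose * (A * S)).conjTranspose *
      (T.conjTranspose * (B * S))) * S.conjTranspose =
      (S * S.conjTranspose) * A.conjTranspose * (T * T.conjTranspose) * B *
        (S * S.conjTranspose) := by
    intro A B
    simp only [Matrix.conjTranspose_mul, Matrix.conjTranspose_conjTranspose, Matrix.mul_assoc]
  simp only [heis_eq_blockOp, blockOp_changeBasis, e, hS.2, hT.2, Matrix.one_mul, Matrix.mul_one]

theorem noSignalA_of_heis_eq {Q : Type} [Fintype Q] [DecidableEq Q] {G : Type} [Fintype G]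
    {S : Matrix P Q ℂ} {U : Matrix (AI × BI × F) (P × AO × BO) ℂ}
    {U' : Matrix (AI × BI × G) (Q × AO × BO) ℂ}
    (h : ∀ i j k l a a' b b',
      heis U i j k l a a' b b' = S * heis U' i j k l a a' b b' * S.conjTranspose)
    (hU' : NoSignalA U') : NoSignalA U := by
  intro i j a a' a₀ b b'
  simp only [h, ← Matrix.sum_mul, ← Matrix.mul_sum]
  rw [hU' i j a a' a₀ b b']
  split_ifs <;> simp

theorem Admissible.of_heis_eq {Q : Type} [Fintype Q] [DecidableEq Q] {G : Type} [Fintype G]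
    [DecidableEq G] {S : Matrix P Q ℂ} {U : Matrix (AI × BI × F) (P × AO × BO) ℂ}
    {U' : Matrix (AI × BI × G) (Q × AO × BO) ℂ}
    (h : ∀ i j k l a a' b b',
      heis U i j k l a a' b b' = S * heis U' i j k l a a' b b' * S.conjTranspose)
    (hU' : Admissible U') : Admissible U := by
  refine ⟨noSignalA_of_heis_eq h hU'.noSignalA,
    noSignalA_of_heis_eq (S := S) (U := swapOp U) (U' := swapOp U') (fun k l i j b b' a a' => h i j k l a a' b b') hU'.noSignalB, ?_⟩
  intro i j k l a a' a₀ b b' b₀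
  have h1 := congrArg (fun M => S * M * S.conjTranspose) (hU'.noLoop i j k l a a' a₀ b b' b₀)
  simp only [h]
  by_cases ha : a = a' <;> by_cases hb : b = b' <;>
    simpa [ha, hb, Matrix.mul_sub, Matrix.sub_mul] using h1

theorem heis_directSumOp {P₁ P₂ F₁ F₂ : Type} [Fintype F₁] [Fintype F₂] [Fintype P₁]
    [DecidableEq P₁] [Fintype P₂] [DecidableEq P₂]
    (U₁ : Matrix (AI × BI × F₁) (P₁ × AO × BO) ℂ)
    (U₂ : Matrix (AI × BI × F₂) (P₂ × AO × BO) ℂ) (i j : AI) (k l : BI) (a a' : AO) (b b' : BO) :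
    heis (directSumOp U₁ U₂) i j k l a a' b b' =
      Matrix.fromBlocks (heis U₁ i j k l a a' b b') 0 0 (heis U₂ i j k l a a' b b') := by
  ext (p | p) (q | q) <;> simp [heis, directSumOp]

/-- The blocks of the first summand do not depend on `BO` and those of the second not on `AO`. Each
makes the mixed difference in the no-loop condition vanish. -/
theorem admissible_directSumOp {P₁ P₂ F₁ F₂ : Type} [Fintype F₁] [DecidableEq F₁] [Fintype F₂]
    [DecidableEq F₂] [Fintype P₁] [DecidableEq P₁] [Fintype P₂] [DecidableEq P₂]
    {U₁ : Matrix (AI × BI × F₁) (P₁ × AO × BO) ℂ}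
    {U₂ : Matrix (AI × BI × F₂) (P₂ × AO × BO) ℂ} (h₁ : OrderedAB U₁)
    (h₂ : OrderedAB (swapOp U₂)) : Admissible (directSumOp U₁ U₂) := by
  have hs : ∀ {n : Type} [Fintype n] (A : n → Matrix P₁ P₁ ℂ) (B : n → Matrix P₂ P₂ ℂ),
      ∑ k, Matrix.fromBlocks (A k) 0 0 (B k) = Matrix.fromBlocks (∑ k, A k) 0 0 (∑ k, B k) := by
    intro n _ A B
    ext (p | p) (q | q) <;> simp [Matrix.sum_apply]
  have hA₂ : ∀ i j k l a a' a₀ b b', heis U₂ i j k l a a' b b' =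
      if a = a' then heis U₂ i j k l a₀ a₀ b b' else 0 :=
    fun i j k l a a' a₀ b b' => h₂.first k l i j b b' a a' a₀
  refine ⟨?_, ?_, ?_⟩
  · intro i j a a' a₀ b b'
    simp only [heis_directSumOp, hs]
    have h3 := h₁.second i j a a' a₀ b b'
    have h4 := Finset.sum_congr rfl fun k (_ : k ∈ Finset.univ) => hA₂ i j k k a a' a₀ b b'
    rw [h3, h4]
    by_cases ha : a = a' <;> simp [ha]
  · intro k l b b' b₀ a a'
    simp only [heis_swapOp, heis_directSumOp, hs]
    have h3 := h₂.second k l b b' b₀ a a'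
    simp only [heis_swapOp] at h3
    have h4 := Finset.sum_congr rfl fun i (_ : i ∈ Finset.univ) => h₁.first i i k l a a' b b' b₀
    rw [h3, h4]
    by_cases hb : b = b' <;> simp [hb]
  · intro i j k l a a' a₀ b b' b₀
    simp only [heis_directSumOp]
    rw [h₁.first i j k l a a' b b' b₀, h₁.first i j k l a₀ a₀ b b' b₀,
      hA₂ i j k l a a' a₀ b b', hA₂ i j k l a a' a₀ b₀ b₀]
    ext (p | p) (q | q) <;> by_cases ha : a = a' <;> by_cases hb : b = b' <;> simp [ha, hb]

theorem isUnitaryOp_swapOp {U : Matrix (AI × BI × F) (P × AO × BO) ℂ} (hU : IsUnitaryOp U) :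
    IsUnitaryOp (swapOp U) := by
  let e : (BI × AI × F) ≃ (AI × BI × F) :=
    ⟨fun z => (z.2.1, z.1, z.2.2), fun z => (z.2.1, z.1, z.2.2), fun _ => rfl, fun _ => rfl⟩
  let g : (P × BO × AO) ≃ (P × AO × BO) :=
    ⟨fun z => (z.1, z.2.2, z.2.1), fun z => (z.1, z.2.2, z.2.1), fun _ => rfl, fun _ => rfl⟩
  have h : swapOp U = U.submatrix e g := rfl
  constructor
  · rw [h, Matrix.conjTranspose_submatrix, Matrix.submatrix_mul_equiv, hU.1,
      Matrix.submatrix_one_equiv]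
  · rw [h, Matrix.conjTranspose_submatrix, Matrix.submatrix_mul_equiv, hU.2,
      Matrix.submatrix_one_equiv]

theorem isCombBA_iff_swapOp (U : Matrix (AI × BI × F) (P × AO × BO) ℂ) :
    IsCombBA (choiProj U) ↔ IsCombAB (choiProj (swapOp U)) := Iff.rfl

theorem OrderedAB.representsCombBA [Nonempty AO] [Nonempty AI] [Nonempty BO]
    {U : Matrix (AI × BI × F) (P × AO × BO) ℂ} (h : OrderedAB (swapOp U)) (hU : IsUnitaryOp U) :
    RepresentsCombBA U :=
  ⟨hU, (isCombBA_iff_swapOp U).2 (h.representsCombAB (isUnitaryOp_swapOp hU)).2⟩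

theorem swapOp_channel_sum {U : Matrix (AI × BI × F) (P × AO × BO) ℂ}
    (hU : IsSuperchannel₂ (choiProj U)) {EA : Matrix (AI × AO) (AI × AO) ℂ}
    {EB : Matrix (BI × BO) (BI × BO) ℂ} (hA : IsChannelChoi EA) (hB : IsChannelChoi EB)
    (p p' : P) :
    ∑ u, ∑ v, (∑ z, ∑ w, heis (swapOp U) v.1 u.1 w.1 z.1 v.2 u.2 w.2 z.2 p' p * EA z w) * EB u v =
      if p = p' then 1 else 0 := by
  rw [← hU.channel_sum hA hB p p']
  simp only [Finset.sum_mul, heis_swapOp]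
  simp only [Finset.sum_comm (s := (Finset.univ : Finset (BI × BO)))
    (t := (Finset.univ : Finset (AI × AO))), mul_assoc, mul_comm (EA _ _)]

theorem IsSuperchannel₂.admissible {U : Matrix (AI × BI × F) (P × AO × BO) ℂ}
    (hU : IsSuperchannel₂ (choiProj U)) : Admissible U := by
  obtain ⟨h1, h2⟩ := noLoop_of_channel_sum fun EA EB hA hB => hU.channel_sum hA hB
  obtain ⟨-, h3⟩ := noLoop_of_channel_sum (U := swapOp U) fun EB EA hB hA =>
    swapOp_channel_sum hU hA hB
  exact ⟨h2, h3, h1⟩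

/-- Both kinds of operators satisfy the causality conditions. -/
theorem admissible_of_represents [Nonempty AI] [Nonempty BI]
    {U : Matrix (AI × BI × F) (P × AO × BO) ℂ}
    (hU : RepresentsPureSuperchannel U ∨ RepresentsDirectSumOfPureCombs U) :
    IsUnitaryOp U ∧ Admissible U := by
  rcases hU with ⟨h, hW⟩ | ⟨h, p₁, p₂, f₁, f₂, S, T, U₁, U₂, hS, hT, h₁, h₂, hsum⟩
  · exact ⟨h, hW.1.admissible⟩
  · have h₂' : IsCombAB (choiProj (swapOp U₂)) := h₂.2
    refine ⟨h, Admissible.of_heis_eq (S := S) (fun i j k l a a' b b' => ?_)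
      (admissible_directSumOp h₁.2.orderedAB h₂'.orderedAB)⟩
    rw [← hsum]
    exact heis_eq_of_changeBasis hS hT U i j k l a a' b b'

end TwoSlots

/-! ### Systems of matrix units with blocks -/

theorem matrix_mul_ite {X Y Z : Type} [Fintype Y] (c : Prop) [Decidable c] (A : Matrix X Y ℂ)
    (B : Matrix Y Z ℂ) : (A * if c then B else 0) = if c then A * B else 0 := by
  split_ifs <;> simp

theorem matrix_ite_mul {X Y Z : Type} [Fintype Y] (c : Prop) [Decidable c] (A : Matrix X Y ℂ)
    (B : Matrix Y Z ℂ) : (if c then A else 0) * B = if c then A * B else 0 := by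
  split_ifs <;> simp

/-- Blocks of a system of matrix units on `P ⊗ κ`. -/
structure MatrixUnits {ι κ P : Type} [Fintype ι] [DecidableEq ι] [Fintype κ] [DecidableEq κ]
    [Fintype P] [DecidableEq P] (X : ι → ι → κ → κ → Matrix P P ℂ) : Prop where
  conj : ∀ i j b b', (X i j b b').conjTranspose = X j i b' b
  mul : ∀ i j k l b b', ∑ c, X i j b c * X k l c b' = if j = k then X i l b b' else 0
  sum : ∀ b b', ∑ i, X i i b b' = if b = b' then 1 else 0

/-- A vector on which matrix units act without changing `κ` spans, under their action, an
isometric copy of `ℂ^ι`. -/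
theorem MatrixUnits.exists_isometry {ι κ P : Type} [Fintype ι] [DecidableEq ι] [Fintype κ]
    [DecidableEq κ] [Fintype P] [DecidableEq P] {X : ι → ι → κ → κ → Matrix P P ℂ}
    (hX : MatrixUnits X) (b₀ : κ) (v : P → ℂ) (hv : v ≠ 0)
    (hjump : ∀ i j b b', (X i j b b').mulVec v = if b = b' then (X i j b₀ b₀).mulVec v else 0) :
    ∃ (i₀ : ι) (c : ℂ) (M : Matrix P ι ℂ), M.conjTranspose * M = 1 ∧
      (∀ i j b b', X i j b b' * M = if b = b' then M * Matrix.single i j (1 : ℂ) else 0) ∧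
      ∀ i p, M p i = c * (X i i₀ b₀ b₀).mulVec v p := by
  -- On the vectors X_kl v the matrix units multiply as if κ were absent, since `hjump` collapses
  -- the sum over c.
  have hmul : ∀ i j k l b b', (X i j b b').mulVec ((X k l b₀ b₀).mulVec v) =
      if b = b' then if j = k then (X i l b₀ b₀).mulVec v else 0 else 0 := by
    intro i j k l b b'
    have h1 := congrArg (fun A => A.mulVec v) (hX.mul i j k l b b')
    have h2 : ∀ c, (X i j b c).mulVec ((X k l c b').mulVec v) =
        if c = b' then (X i j b c).mulVec ((X k l b₀ b₀).mulVec v) else 0 := by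
      intro c
      rw [hjump k l c b']
      split_ifs <;> simp
    simp only [Matrix.sum_mulVec, ← Matrix.mulVec_mulVec, h2, Finset.sum_ite_eq', Finset.mem_univ,
      if_true] at h1
    rw [h1]
    by_cases hj : j = k
    · rw [if_pos hj, hjump i l b b', if_pos hj]
    · simp [hj]
  obtain ⟨i₀, hi₀⟩ : ∃ i₀, (X i₀ i₀ b₀ b₀).mulVec v ≠ 0 := by
    by_contra! h
    apply hv
    have h1 := congrArg (fun A => A.mulVec v) (hX.sum b₀ b₀)
    simpa [Matrix.sum_mulVec, h] using h1.symm
  -- These vectors are orthogonal and of equal norm, as ⟨X_{i i₀} v, X_{j i₀} v⟩ = ⟨v, X_{i₀ i} X_{j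
  -- i₀} v⟩. Dividing by the common norm √r gives the columns of the isometry.
  let w : ι → P → ℂ := fun i => (X i i₀ b₀ b₀).mulVec v
  have hw : ∀ i j, star (w i) ⬝ᵥ w j = if i = j then star (w i₀) ⬝ᵥ w i₀ else 0 := by
    have h1 : ∀ i j, star (w i) ⬝ᵥ w j = if i = j then star v ⬝ᵥ w i₀ else 0 := by
      intro i j
      simp only [w]
      rw [Matrix.star_mulVec, hX.conj, ← Matrix.dotProduct_mulVec, hmul]
      by_cases hij : i = j <;> simp [hij]
    intro i j
    rw [h1, h1, if_pos rfl]
  obtain ⟨r, hr⟩ : ∃ r : ℝ, 0 < r ∧ star (w i₀) ⬝ᵥ w i₀ = (r : ℂ) := by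
    have h1 : 0 < star (w i₀) ⬝ᵥ w i₀ := Matrix.dotProduct_star_self_pos_iff.2 hi₀
    obtain ⟨h2, h3⟩ := Complex.pos_iff.1 h1
    exact ⟨_, h2, Complex.ext rfl h3.symm⟩
  have hc : (((Real.sqrt r)⁻¹ : ℝ) : ℂ) * (((Real.sqrt r)⁻¹ : ℝ) : ℂ) * (r : ℂ) = 1 := by
    rw [← Complex.ofReal_mul, ← Complex.ofReal_mul, ← mul_inv, Real.mul_self_sqrt hr.1.le,
      inv_mul_cancel₀ hr.1.ne', Complex.ofReal_one]
  set c : ℂ := (((Real.sqrt r)⁻¹ : ℝ) : ℂ)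
  refine ⟨i₀, c, Matrix.of fun p i => c * w i p, ?_, ?_, fun i p => rfl⟩
  · ext i j
    have h1 := hw i j
    rw [hr.2] at h1
    simp only [dotProduct, Pi.star_apply] at h1
    have hcs : star c = c := Complex.conj_ofReal _
    simp only [Matrix.mul_apply, Matrix.conjTranspose_apply, Matrix.of_apply, star_mul', hcs,
      Matrix.one_apply]
    have h2 : ∀ p, c * star (w i p) * (c * w j p) = c * c * (star (w i p) * w j p) :=
      fun p => by ring
    simp only [h2, ← Finset.mul_sum, h1, mul_ite, mul_zero, hc]
  · intro i j b b'
    ext p k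
    have h1 := congrFun (hmul i j k i₀ b b') p
    have h2 : (X i j b b' * Matrix.of fun p i => c * w i p) p k =
        c * (X i j b b').mulVec (w k) p := by
      simp only [Matrix.mul_apply, Matrix.of_apply, Matrix.mulVec, dotProduct, Finset.mul_sum]
      exact Finset.sum_congr rfl fun _ _ => by ring
    rw [h2, h1]
    by_cases hb : b = b'
    · rw [if_pos hb, if_pos hb, Matrix.mul_apply]
      by_cases hj : j = k
      · subst hj
        simp [Matrix.single_apply, w]
      · simp [hj]
    · simp [hb]

/-! ### The commuting matrix units of AI and BI -/

section TwoSlots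

variable {P AI AO BI BO F : Type}
  [Fintype P] [DecidableEq P] [Fintype AI] [DecidableEq AI] [Fintype AO] [DecidableEq AO]
  [Fintype BI] [DecidableEq BI] [Fintype BO] [DecidableEq BO] [Fintype F] [DecidableEq F]

/-- The blocks of `Uᴴ (|i⟩⟨j| ⊗ 1 ⊗ 1) U`, an operator on `P ⊗ BO` if `AI` does not depend
on `AO`. -/
def unitsA (U : Matrix (AI × BI × F) (P × AO × BO) ℂ) (a₀ : AO) (i j : AI) (b b' : BO) :
    Matrix P P ℂ :=
  ∑ k, heis U i j k k a₀ a₀ b b'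

/-- The blocks of `Uᴴ (1 ⊗ |k⟩⟨l| ⊗ 1) U`. -/
def unitsB (U : Matrix (AI × BI × F) (P × AO × BO) ℂ) (b₀ : BO) (k l : BI) (a a' : AO) :
    Matrix P P ℂ :=
  unitsA (swapOp U) b₀ k l a a'

theorem sum_blockOp_mul_conjTranspose {U : Matrix (AI × BI × F) (P × AO × BO) ℂ}
    (hU : IsUnitaryOp U) (i j : AI) (k l : BI) :
    ∑ a, ∑ b, blockOp U i k a b * (blockOp U j l a b).conjTranspose =
      if i = j then if k = l then 1 else 0 else 0 := by
  ext f g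
  have h := congrFun (congrFun hU.2 (i, k, f)) (j, l, g)
  simp only [Matrix.mul_apply, Fintype.sum_prod_type, Matrix.conjTranspose_apply] at h
  simp only [Matrix.sum_apply, Matrix.mul_apply, blockOp, Matrix.of_apply,
    Matrix.conjTranspose_apply]
  simp only [Finset.sum_comm (s := (Finset.univ : Finset BO)) (t := (Finset.univ : Finset P)),
    Finset.sum_comm (s := (Finset.univ : Finset AO)) (t := (Finset.univ : Finset P))]
  rw [h]
  by_cases hi : i = j <;> by_cases hk : k = l <;> simp [Matrix.one_apply, hi, hk]

theorem sum_conjTranspose_mul_blockOp {U : Matrix (AI × BI × F) (P × AO × BO) ℂ}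
    (hU : IsUnitaryOp U) (a a' : AO) (b b' : BO) :
    ∑ i, ∑ k, (blockOp U i k a b).conjTranspose * blockOp U i k a' b' =
      if a = a' then if b = b' then 1 else 0 else 0 := by
  ext p q
  have h := congrFun (congrFun hU.1 (p, a, b)) (q, a', b')
  simp only [Matrix.mul_apply, Fintype.sum_prod_type, Matrix.conjTranspose_apply] at h
  simp only [Matrix.sum_apply, Matrix.mul_apply, blockOp, Matrix.of_apply,
    Matrix.conjTranspose_apply]
  rw [h]
  by_cases hi : a = a' <;> by_cases hk : b = b' <;> simp [Matrix.one_apply, hi, hk]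

theorem NoSignalA.sum_heis {U : Matrix (AI × BI × F) (P × AO × BO) ℂ} (h : NoSignalA U)
    (a₀ : AO) (i j : AI) (a a' : AO) (b b' : BO) :
    ∑ k, (blockOp U i k a b).conjTranspose * blockOp U j k a' b' =
      if a = a' then unitsA U a₀ i j b b' else 0 := by
  simp only [← heis_eq_blockOp]
  exact h i j a a' a₀ b b'

/-- In blocks, U · Uᴴ(|i⟩⟨j| ⊗ 1 ⊗ 1)U = (|i⟩⟨j| ⊗ 1 ⊗ 1)U, where no-signalling removes the sum over
`AO`. -/
theorem NoSignalA.intertwine {U : Matrix (AI × BI × F) (P × AO × BO) ℂ} (h : NoSignalA U)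
    (hU : IsUnitaryOp U) (a₀ : AO) (i' i j : AI) (k : BI) (a : AO) (b : BO) :
    ∑ c, blockOp U i' k a c * unitsA U a₀ i j c b = if i' = i then blockOp U j k a b else 0 := by
  have h1 : ∑ c, blockOp U i' k a c * unitsA U a₀ i j c b =
      ∑ a', ∑ c, blockOp U i' k a' c *
        ∑ m, (blockOp U i m a' c).conjTranspose * blockOp U j m a b := by
    simp only [h.sum_heis a₀, matrix_mul_ite]
    rw [Finset.sum_comm]
    simp
  rw [h1]
  simp only [Matrix.mul_sum, ← Matrix.mul_assoc]
  simp only [Finset.sum_comm (s := (Finset.univ : Finset BO)) (t := (Finset.univ : Finset BI)),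
    Finset.sum_comm (s := (Finset.univ : Finset AO)) (t := (Finset.univ : Finset BI)),
    ← Matrix.sum_mul, sum_blockOp_mul_conjTranspose hU]
  by_cases hi : i' = i <;> simp [hi, matrix_ite_mul]

theorem NoSignalA.matrixUnits {U : Matrix (AI × BI × F) (P × AO × BO) ℂ} (h : NoSignalA U)
    (hU : IsUnitaryOp U) (a₀ : AO) : MatrixUnits (unitsA U a₀) where
  conj i j b b' := by
    simp only [unitsA, heis_eq_blockOp, Matrix.conjTranspose_sum, Matrix.conjTranspose_mul,
      Matrix.conjTranspose_conjTranspose]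
  mul i j k l b b' := by
    have h1 : ∀ c, unitsA U a₀ i j b c * unitsA U a₀ k l c b' =
        ∑ m, (blockOp U i m a₀ b).conjTranspose * (blockOp U j m a₀ c * unitsA U a₀ k l c b') := by
      intro c
      rw [unitsA, Matrix.sum_mul]
      simp only [heis_eq_blockOp, Matrix.mul_assoc]
    simp only [h1]
    rw [Finset.sum_comm]
    simp only [← Matrix.mul_sum, h.intertwine hU]
    by_cases hj : j = k
    · simp [hj, unitsA, heis_eq_blockOp]
    · simp [hj]
  sum b b' := by
    have := sum_conjTranspose_mul_blockOp hU a₀ a₀ b b'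
    simpa [unitsA, heis_eq_blockOp] using this

/-- The first factor acts trivially on `AO` and the second on `BO`, so the operator product on P ⊗
AO ⊗ BO is a plain product of blocks on `P`. With the opposite order this gives blockwise
commutation. -/
theorem Admissible.unitsA_mul_unitsB {U : Matrix (AI × BI × F) (P × AO × BO) ℂ} (h : Admissible U)
    (hU : IsUnitaryOp U) (a₀ : AO) (b₀ : BO) (i j : AI) (k l : BI) (a a' : AO) (b b' : BO) :
    unitsA U a₀ i j b b' * unitsB U b₀ k l a a' = heis U i j k l a a' b b' := by
  have h1 : ∑ c, ∑ m, (blockOp U i m a b).conjTranspose * (blockOp U j m c b' *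
      unitsB U b₀ k l c a') = unitsA U a₀ i j b b' * unitsB U b₀ k l a a' := by
    simp only [← Matrix.mul_assoc, ← Matrix.sum_mul, h.noSignalA.sum_heis a₀]
    simp
  have h2 : ∀ m, ∑ c, blockOp U j m c b' * unitsB U b₀ k l c a' =
      if m = k then blockOp U j l a' b' else 0 := fun m =>
    h.noSignalB.intertwine (isUnitaryOp_swapOp hU) b₀ m k l j b' a'
  rw [← h1, Finset.sum_comm]
  simp only [← Matrix.mul_sum, h2]
  simp [heis_eq_blockOp, matrix_mul_ite]

theorem Admissible.unitsB_mul_unitsA {U : Matrix (AI × BI × F) (P × AO × BO) ℂ} (h : Admissible U)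
    (hU : IsUnitaryOp U) (a₀ : AO) (b₀ : BO) (i j : AI) (k l : BI) (a a' : AO) (b b' : BO) :
    unitsB U b₀ k l a a' * unitsA U a₀ i j b b' = heis U i j k l a a' b b' :=
  h.swap.unitsA_mul_unitsB (isUnitaryOp_swapOp hU) b₀ a₀ k l i j b b' a a'

/-- The part of `Uᴴ (|i⟩⟨j| ⊗ 1 ⊗ 1) U` which depends on `BO`. -/
def jumpA (U : Matrix (AI × BI × F) (P × AO × BO) ℂ) (a₀ : AO) (b₀ : BO) (i j : AI) (b b' : BO) :
    Matrix P P ℂ :=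
  unitsA U a₀ i j b b' - if b = b' then unitsA U a₀ i j b₀ b₀ else 0

/-- The part of `Uᴴ (1 ⊗ |k⟩⟨l| ⊗ 1) U` which depends on `AO`. -/
def jumpB (U : Matrix (AI × BI × F) (P × AO × BO) ℂ) (a₀ : AO) (b₀ : BO) (k l : BI) (a a' : AO) :
    Matrix P P ℂ :=
  jumpA (swapOp U) b₀ a₀ k l a a'

/-- The no-loop condition is a mixed second difference of `heis`; since `heis` is a product, the
difference factors. -/
theorem Admissible.jumpA_mul_jumpB {U : Matrix (AI × BI × F) (P × AO × BO) ℂ} (h : Admissible U)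
    (hU : IsUnitaryOp U) (a₀ : AO) (b₀ : BO) (i j : AI) (k l : BI) (a a' : AO) (b b' : BO) :
    jumpA U a₀ b₀ i j b b' * jumpB U a₀ b₀ k l a a' = 0 := by
  have h1 := h.noLoop i j k l a a' a₀ b b' b₀
  have h2 : jumpB U a₀ b₀ k l a a' =
    unitsB U b₀ k l a a' - if a = a' then unitsB U b₀ k l a₀ a₀ else 0 := rfl
  rw [h2, jumpA]
  simp only [← h.unitsA_mul_unitsB hU a₀ b₀] at h1
  by_cases ha : a = a' <;> by_cases hb : b = b' <;>
    simp [ha, hb] at h1 ⊢ <;>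
      simp [Matrix.mul_sub, Matrix.sub_mul, h1, sub_eq_zero, sub_eq_sub_iff_sub_eq_sub]

theorem Admissible.jumpA_conj {U : Matrix (AI × BI × F) (P × AO × BO) ℂ} (h : Admissible U)
    (hU : IsUnitaryOp U) (a₀ : AO) (b₀ : BO) (i j : AI) (b b' : BO) :
    (jumpA U a₀ b₀ i j b b').conjTranspose = jumpA U a₀ b₀ j i b' b := by
  have hc := (h.noSignalA.matrixUnits hU a₀).conj
  by_cases hb : b = b'
  · simp [jumpA, hb, hc]
  · simp [jumpA, hb, hc, Ne.symm hb]

theorem Admissible.jumpA_comm_unitsB {U : Matrix (AI × BI × F) (P × AO × BO) ℂ} (h : Admissible U)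
    (hU : IsUnitaryOp U) (a₀ : AO) (b₀ : BO) (i j : AI) (k l : BI) (a a' : AO) (b b' : BO) :
    jumpA U a₀ b₀ i j b b' * unitsB U b₀ k l a a' =
      unitsB U b₀ k l a a' * jumpA U a₀ b₀ i j b b' := by
  by_cases hb : b = b' <;> simp [jumpA, hb, Matrix.mul_sub, Matrix.sub_mul,
    h.unitsA_mul_unitsB hU, h.unitsB_mul_unitsA hU]

theorem Admissible.orderedAB {U : Matrix (AI × BI × F) (P × AO × BO) ℂ} (h : Admissible U)
    (hU : IsUnitaryOp U) (a₀ : AO) (b₀ : BO)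
    (h0 : ∀ i j b b', jumpA U a₀ b₀ i j b b' = 0) : OrderedAB U := by
  refine ⟨fun i j k l a a' b b' b₁ => ?_, h.noSignalA⟩
  have h1 : ∀ b b', unitsA U a₀ i j b b' = if b = b' then unitsA U a₀ i j b₀ b₀ else 0 :=
    fun b b' => sub_eq_zero.1 (h0 i j b b')
  simp only [← h.unitsA_mul_unitsB hU a₀ b₀]
  rw [h1 b b', h1 b₁ b₁]
  by_cases hb : b = b' <;> simp [hb]

end TwoSlots

theorem isUnitaryOp_of_isometry {X Y : Type} [Fintype X] [DecidableEq X] [Fintype Y]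
    [DecidableEq Y] {A : Matrix Y X ℂ} (h : A.conjTranspose * A = 1)
    (hc : Fintype.card X = Fintype.card Y) : IsUnitaryOp A :=
  ⟨h, (Matrix.mul_eq_one_comm_of_card_eq _ _ _ hc).1 h⟩

/-! ### Invariant subspaces of P and the product form -/

section TwoSlots

variable {P AI AO BI BO F : Type}
  [Fintype P] [DecidableEq P] [Fintype AI] [DecidableEq AI] [Fintype AO] [DecidableEq AO]
  [Fintype BI] [DecidableEq BI] [Fintype BO] [DecidableEq BO] [Fintype F] [DecidableEq F]

theorem mul_single_one_apply {X Y Z : Type} [Fintype Y] [DecidableEq Y] [DecidableEq Z]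
    (A : Matrix X Y ℂ) (i : Y) (j t : Z) (s : X) :
    (A * Matrix.single i j (1 : ℂ)) s t = if j = t then A s i else 0 := by
  by_cases h : j = t
  · subst h; simp
  · simp [h, Ne.symm h]

theorem single_one_mul_apply {X Y Z : Type} [Fintype Y] [DecidableEq Y] [DecidableEq X]
    (A : Matrix Y Z ℂ) (i s : X) (j : Y) (t : Z) :
    (Matrix.single i j (1 : ℂ) * A) s t = if s = i then A j t else 0 := by
  by_cases h : s = i
  · subst h; simp
  · simp [h]

/-- If `Uᴴ (L(BI)) U` acts by scalars on the range of `M`, these form matrix units on `AO`. -/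
theorem Admissible.exists_scalars {U : Matrix (AI × BI × F) (P × AO × BO) ℂ} (h : Admissible U)
    (hU : IsUnitaryOp U) (a₀ : AO) (b₀ : BO) (i₀ : AI) {M : Matrix P AI ℂ}
    (hM : M.conjTranspose * M = 1)
    (hX : ∀ i j, unitsA U a₀ i j b₀ b₀ * M = M * Matrix.single i j (1 : ℂ))
    (hY : ∀ k l a a', unitsB U b₀ k l a a' * M =
      M * (M.conjTranspose * (unitsB U b₀ k l a a' * M))) :
    ∃ β : BI → BI → Matrix AO AO ℂ, MatrixUnits (fun k l (_ _ : Unit) => β k l) ∧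
      ∀ k l a a', unitsB U b₀ k l a a' * M = β k l a a' • M := by
  have hB := h.noSignalB.matrixUnits (isUnitaryOp_swapOp hU) b₀
  have hA := h.noSignalA.matrixUnits hU a₀
  have hX' : ∀ i j, M.conjTranspose * unitsA U a₀ i j b₀ b₀ =
      Matrix.single i j (1 : ℂ) * M.conjTranspose := by
    intro i j
    have h1 := congrArg Matrix.conjTranspose (hX j i)
    simpa [Matrix.conjTranspose_mul, hA.conj] using h1
  -- Compressed to the range of M, `unitsB` commutes with all matrix units on `AI` and is therefore
  -- scalar; the diagonal entry at i₀ reads off the scalar.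
  let β : BI → BI → Matrix AO AO ℂ := fun k l => Matrix.of fun a a' =>
    (M.conjTranspose * (unitsB U b₀ k l a a' * M)) i₀ i₀
  have hβ : ∀ k l a a', M.conjTranspose * (unitsB U b₀ k l a a' * M) = β k l a a' • 1 := by
    intro k l a a'
    ext s t
    have h1 : M.conjTranspose * (unitsB U b₀ k l a a' * M) * Matrix.single t i₀ (1 : ℂ) =
        Matrix.single t i₀ (1 : ℂ) * (M.conjTranspose * (unitsB U b₀ k l a a' * M)) := by
      rw [← Matrix.mul_assoc (Matrix.single t i₀ (1 : ℂ)), ← hX', Matrix.mul_assoc,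
        Matrix.mul_assoc, ← hX, ← Matrix.mul_assoc (unitsB U b₀ k l a a'),
        h.unitsB_mul_unitsA hU, ← h.unitsA_mul_unitsB hU a₀ b₀]
      simp only [Matrix.mul_assoc]
    have h2 := congrFun (congrFun h1 s) i₀
    rw [mul_single_one_apply, single_one_mul_apply, if_pos rfl] at h2
    rw [h2]
    simp [β, Matrix.one_apply]
  have hs : ∀ k l a a', unitsB U b₀ k l a a' * M = β k l a a' • M := by
    intro k l a a'
    rw [hY, hβ, Matrix.mul_smul, Matrix.mul_one]
  refine ⟨β, ⟨?_, ?_, ?_⟩, hs⟩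
  · intro k l _ _
    ext a a'
    have h1 := congrArg Matrix.conjTranspose (hβ k l a' a)
    rw [Matrix.conjTranspose_mul, Matrix.conjTranspose_mul, Matrix.conjTranspose_conjTranspose,
      show (unitsB U b₀ k l a' a).conjTranspose = unitsB U b₀ l k a a' from hB.conj k l a' a,
      Matrix.mul_assoc, hβ] at h1
    simpa using (congrFun (congrFun h1 i₀) i₀).symm
  · intro k l m n _ _
    simp only [Finset.univ_unique, Finset.sum_singleton]
    ext a a'
    have h1 : ∑ c, unitsB U b₀ k l a c * unitsB U b₀ m n c a' =
      if l = m then unitsB U b₀ k n a a' else 0 := hB.mul k l m n a a'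
    have h2 := congrArg (fun A => M.conjTranspose * (A * M)) h1
    simp only [Matrix.sum_mul, Matrix.mul_sum, Matrix.mul_assoc, hs, Matrix.mul_smul, hM,
      matrix_ite_mul, matrix_mul_ite] at h2
    have h3 := congrFun (congrFun h2 i₀) i₀
    simp only [Matrix.sum_apply, Matrix.smul_apply, Matrix.one_apply_eq, smul_eq_mul, mul_one] at h3
    rw [Matrix.mul_apply]
    by_cases hl : l = m <;> simpa [hl, mul_comm] using h3
  · intro _ _
    ext a a'
    have h1 : ∑ k, unitsB U b₀ k k a a' = if a = a' then 1 else 0 := hB.sum a a'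
    have h2 := congrArg (fun A => M.conjTranspose * (A * M)) h1
    simp only [Matrix.sum_mul, Matrix.mul_sum, hs, Matrix.mul_smul, hM,
      matrix_ite_mul, matrix_mul_ite, Matrix.one_mul] at h2
    have h3 := congrFun (congrFun h2 i₀) i₀
    simp only [Matrix.sum_apply, Matrix.smul_apply, Matrix.one_apply_eq, smul_eq_mul, mul_one] at h3
    rw [Matrix.sum_apply]
    by_cases ha : a = a' <;> simpa [ha, Matrix.one_apply] using h3

/-- The form of `U` on a subspace of `P`, the range of `M`, which is sent to `AI`. -/
theorem Admissible.product_form {U : Matrix (AI × BI × F) (P × AO × BO) ℂ} (h : Admissible U)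
    (hU : IsUnitaryOp U) (a₀ : AO) (b₀ : BO) [Nonempty AI]
    (hc : Fintype.card BI = Fintype.card AO) {M : Matrix P AI ℂ}
    (hM : M.conjTranspose * M = 1)
    (hX : ∀ i j b b', unitsA U a₀ i j b b' * M =
      if b = b' then M * Matrix.single i j (1 : ℂ) else 0)
    (hY : ∀ k l a a', unitsB U b₀ k l a a' * M =
      M * (M.conjTranspose * (unitsB U b₀ k l a a' * M))) :
    ∃ (N : Matrix BI AO ℂ) (J : Matrix F BO ℂ), IsUnitaryOp N ∧ J.conjTranspose * J = 1 ∧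
      ∀ i k a b f i', (blockOp U i k a b * M) f i' = if i = i' then N k a * J f b else 0 := by
  obtain ⟨i₀⟩ := ‹Nonempty AI›
  obtain ⟨k₀⟩ : Nonempty BI := by
    rw [← Fintype.card_pos_iff, hc]
    exact Fintype.card_pos_iff.2 ⟨a₀⟩
  obtain ⟨β, hβ, hβM⟩ := h.exists_scalars hU a₀ b₀ i₀ hM (fun i j => by simpa using hX i j b₀ b₀) hY
  -- With trivial κ any nonzero vector of `AO` will do. Equal dimensions make N₀ unitary, and it
  -- conjugates β to the standard matrix units.
  obtain ⟨-, -, N₀, hN₀, hβN, -⟩ := hβ.exists_isometry () (Pi.single a₀ 1)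
    (by intro h0; simpa using congrFun h0 a₀) (fun _ _ _ _ => by simp)
  have hβN' : ∀ k l, β k l * N₀ = N₀ * Matrix.single k l (1 : ℂ) := fun k l => by
    simpa using hβN k l () ()
  have hNu : IsUnitaryOp N₀ := isUnitaryOp_of_isometry hN₀ hc
  let v : BI → AO → BO → F → ℂ := fun k a b f => (blockOp U i₀ k a b * M) f i₀
  have hv : ∀ i k a b f i', (blockOp U i k a b * M) f i' = if i = i' then v k a b f else 0 := by
    intro i k a b f i'
    have h1 := congrArg (· * M) (h.noSignalA.intertwine hU a₀ i i' i₀ k a b)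
    simp only [Matrix.sum_mul, Matrix.mul_assoc, hX, matrix_mul_ite, Finset.sum_ite_eq',
      Finset.mem_univ, if_true, matrix_ite_mul] at h1
    rw [← Matrix.mul_assoc] at h1
    have h2 := congrFun (congrFun h1 f) i₀
    rw [mul_single_one_apply, if_pos rfl] at h2
    rw [h2]
    split_ifs <;> rfl
  have hvβ : ∀ k k' l a b f, ∑ c, v k c b f * β k' l c a = if k = k' then v l a b f else 0 := by
    intro k k' l a b f
    have h0 : ∑ c, blockOp U i₀ k c b * unitsB U b₀ k' l c a =
      if k = k' then blockOp U i₀ l a b else 0 :=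
      h.noSignalB.intertwine (isUnitaryOp_swapOp hU) b₀ k k' l i₀ b a
    have h1 := congrArg (· * M) h0
    simp only [Matrix.sum_mul, Matrix.mul_assoc, hβM, Matrix.mul_smul, matrix_ite_mul] at h1
    have h2 := congrFun (congrFun h1 f) i₀
    simp only [Matrix.sum_apply, Matrix.smul_apply, smul_eq_mul] at h2
    simp only [v, mul_comm _ (β _ _ _ _), h2]
    split_ifs <;> rfl
  -- Writing `AO` in the basis N₀ makes the blocks diagonal in `BI` and independent of the diagonal
  -- index; what remains is J.
  let W : BI → BO → F → BI → ℂ := fun k b f t => ∑ c, v k c b f * N₀ c t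
  have hW : ∀ k b f t, W k b f t = if k = t then W k₀ b f k₀ else 0 := by
    intro k b f t
    have h1 : ∑ a, (∑ c, v k c b f * β t k₀ c a) * N₀ a k₀ = W k b f t := by
      have h2 : ∀ c, (β t k₀ * N₀) c k₀ = N₀ c t := fun c => by
        rw [hβN', mul_single_one_apply, if_pos rfl]
      simp only [W, ← h2, Matrix.mul_apply, Finset.sum_mul, Finset.mul_sum, mul_assoc]
      rw [Finset.sum_comm]
    rw [← h1]
    simp only [hvβ]
    split_ifs <;> simp [W]
  let J : Matrix F BO ℂ := Matrix.of fun f b => W k₀ b f k₀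
  have hvJ : ∀ k a b f, v k a b f = star (N₀ a k) * J f b := by
    intro k a b f
    have h1 : ∑ t, W k b f t * star (N₀ a t) = v k a b f := by
      have h2 : ∀ c, ∑ t, N₀ c t * star (N₀ a t) = if c = a then 1 else 0 := fun c => by
        simpa [Matrix.mul_apply, Matrix.one_apply] using congrFun (congrFun hNu.2 c) a
      simp only [W, Finset.sum_mul, mul_assoc]
      rw [Finset.sum_comm]
      simp only [← Finset.mul_sum, h2]
      simp
    rw [← h1]
    simp only [hW k b f]
    simp [J, mul_comm]
  refine ⟨N₀.conjTranspose, J, ⟨?_, ?_⟩, ?_, ?_⟩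
  · simpa using hNu.2
  · simpa using hNu.1
  · ext b b'
    -- J is an isometry because UᴴU = 1, compressed by M at the index a₀, reduces to JᴴJ once the
    -- row a₀ of N₀ has norm 1.
    have h1 := congrArg (fun A => M.conjTranspose * (A * M))
      (sum_conjTranspose_mul_blockOp hU a₀ a₀ b b')
    simp only [if_true, Matrix.sum_mul, Matrix.mul_sum, matrix_ite_mul, matrix_mul_ite,
      Matrix.one_mul, hM] at h1
    have h2 : ∀ i k, M.conjTranspose * ((blockOp U i k a₀ b).conjTranspose * blockOp U i k a₀ b' * M)
        = (blockOp U i k a₀ b * M).conjTranspose * (blockOp U i k a₀ b' * M) := fun i k => by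
      rw [Matrix.conjTranspose_mul]
      simp only [Matrix.mul_assoc]
    have h3 : ∀ i k, ((blockOp U i k a₀ b * M).conjTranspose * (blockOp U i k a₀ b' * M)) i₀ i₀ =
        if i = i₀ then N₀ a₀ k * star (N₀ a₀ k) * (J.conjTranspose * J) b b' else 0 := fun i k => by
      rw [Matrix.mul_apply, Matrix.mul_apply]
      simp only [Matrix.conjTranspose_apply, hv, hvJ]
      by_cases hi : i = i₀
      · simp only [hi, if_true, Finset.mul_sum, star_mul', star_star]
        exact Finset.sum_congr rfl fun f _ => by ring
      · simp [hi]
    have h4 : ∑ k, N₀ a₀ k * star (N₀ a₀ k) = 1 := by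
      simpa [Matrix.mul_apply, Matrix.one_apply] using congrFun (congrFun hNu.2 a₀) a₀
    have h5 := congrFun (congrFun h1 i₀) i₀
    simp only [h2, Matrix.sum_apply, h3] at h5
    rw [Finset.sum_comm] at h5
    simp only [Finset.sum_ite_eq', Finset.mem_univ, if_true, ← Finset.sum_mul, h4, one_mul] at h5
    rw [h5, Matrix.one_apply]
    split_ifs <;> simp
  · intro i k a b f i'
    rw [hv, hvJ, Matrix.conjTranspose_apply]

/-- Serves the degenerate case d = 0, where no reference indices exist. -/
theorem representsCombAB_of_isEmpty [IsEmpty P] {U : Matrix (AI × BI × F) (P × AO × BO) ℂ}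
    (hU : IsUnitaryOp U) : RepresentsCombAB U := by
  refine ⟨hU, fun AI' BO' _ _ _ _ S _ => (isChannelChoi_iff _).2 ⟨?_, fun x => isEmptyElim x.1⟩⟩
  have h : combLink (choiProj U) S = 0 := by
    ext x
    exact isEmptyElim x.1.1
  rw [h]
  exact Matrix.PosSemidef.zero

theorem Admissible.isometry_of_orderedA {U : Matrix (AI × BI × F) (P × AO × BO) ℂ}
    (h : Admissible U) (hU : IsUnitaryOp U) (a₀ : AO) (b₀ : BO) {v : P → ℂ} (hv : v ≠ 0)
    (h0 : ∀ i j b b', (jumpA U a₀ b₀ i j b b').mulVec v = 0) :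
    ∃ (i₀ : AI) (c : ℂ) (M : Matrix P AI ℂ), M.conjTranspose * M = 1 ∧
      (∀ i j b b', unitsA U a₀ i j b b' * M =
        if b = b' then M * Matrix.single i j (1 : ℂ) else 0) ∧
      ∀ i p, M p i = c * (unitsA U a₀ i i₀ b₀ b₀).mulVec v p := by
  refine (h.noSignalA.matrixUnits hU a₀).exists_isometry b₀ v hv fun i j b b' => ?_
  have h1 := h0 i j b b'
  rw [jumpA, Matrix.sub_mulVec, sub_eq_zero] at h1
  rw [h1]
  split_ifs <;> simp

/-- If `BI` depends on `AO`, there is a subspace of `P` which is sent to `AI`. -/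
theorem Admissible.isometry_of_jumpB {U : Matrix (AI × BI × F) (P × AO × BO) ℂ}
    (h : Admissible U) (hU : IsUnitaryOp U) (a₀ : AO) (b₀ : BO)
    (h0 : ¬ ∀ k l a a', jumpB U a₀ b₀ k l a a' = 0) :
    ∃ M : Matrix P AI ℂ, M.conjTranspose * M = 1 ∧
      (∀ i j b b', unitsA U a₀ i j b b' * M =
        if b = b' then M * Matrix.single i j (1 : ℂ) else 0) ∧
      ∃ (k l : BI) (a a' : AO) (R : Matrix P AI ℂ), M = jumpB U a₀ b₀ k l a a' * R := by
  push Not at h0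
  obtain ⟨k, l, a, a', hne⟩ := h0
  obtain ⟨q, hq⟩ : ∃ q, (jumpB U a₀ b₀ k l a a').mulVec (Pi.single q 1) ≠ 0 := by
    by_contra! hq
    apply hne
    ext p q
    simpa using congrFun (hq q) p
  -- A column of `jumpB` is killed by every `jumpA`, so it can serve as the starting vector. As
  -- `unitsA` commutes with `jumpB`, the whole isometry factors through `jumpB`, which later gives
  -- orthogonality.
  obtain ⟨i₀, c, M, hM, hX, hc⟩ := h.isometry_of_orderedA hU a₀ b₀ hq (fun i j b b' => by
    rw [Matrix.mulVec_mulVec, h.jumpA_mul_jumpB hU, Matrix.zero_mulVec])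
  refine ⟨M, hM, hX, k, l, a, a', Matrix.of fun p i => c * unitsA U a₀ i i₀ b₀ b₀ p q, ?_⟩
  ext p i
  have hcomm : unitsA U a₀ i i₀ b₀ b₀ * jumpB U a₀ b₀ k l a a' =
      jumpB U a₀ b₀ k l a a' * unitsA U a₀ i i₀ b₀ b₀ :=
    (h.swap.jumpA_comm_unitsB (isUnitaryOp_swapOp hU) b₀ a₀ k l i i₀ b₀ b₀ a a').symm
  rw [hc, Matrix.mulVec_mulVec, hcomm]
  simp only [Matrix.mulVec_single_one, Matrix.col_apply, Matrix.mul_apply, Matrix.of_apply,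
    Finset.mul_sum]
  exact Finset.sum_congr rfl fun _ _ => by ring

/-- The subspaces of `P` which are sent to `AI` and to `BI` are orthogonal. -/
theorem Admissible.orthogonal {U : Matrix (AI × BI × F) (P × AO × BO) ℂ}
    (h : Admissible U) (hU : IsUnitaryOp U) (a₀ : AO) (b₀ : BO) (i j : AI) (b b' : BO)
    (k l : BI) (a a' : AO) (R : Matrix P AI ℂ) (R' : Matrix P BI ℂ) :
    (jumpA U a₀ b₀ i j b b' * R').conjTranspose * (jumpB U a₀ b₀ k l a a' * R) = 0 ∧
      ∀ m n c c', (jumpA U a₀ b₀ i j b b' * R').conjTranspose *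
        (unitsB U b₀ m n c c' * (jumpB U a₀ b₀ k l a a' * R)) = 0 := by
  have h1 : ∀ Z : Matrix P AI ℂ, jumpA U a₀ b₀ j i b' b * (jumpB U a₀ b₀ k l a a' * Z) = 0 := by
    intro Z
    rw [← Matrix.mul_assoc, h.jumpA_mul_jumpB hU, Matrix.zero_mul]
  constructor
  · rw [Matrix.conjTranspose_mul, h.jumpA_conj hU, Matrix.mul_assoc, h1, Matrix.mul_zero]
  · intro m n c c'
    rw [Matrix.conjTranspose_mul, h.jumpA_conj hU, Matrix.mul_assoc,
      ← Matrix.mul_assoc (jumpA _ _ _ _ _ _ _),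
      h.jumpA_comm_unitsB hU, Matrix.mul_assoc, h1, Matrix.mul_zero, Matrix.mul_zero]

/-- Any vector of `P` can start the isometry, and when `P` is as large as `AI` its range is all of
`P`, so the product form describes U completely. -/
theorem Admissible.eq_orderedAB [Nonempty AI] {U : Matrix (AI × BI × F) (P × AO × BO) ℂ}
    (h : Admissible U) (hU : IsUnitaryOp U) (a₀ : AO) (b₀ : BO)
    (hB : Fintype.card BI = Fintype.card AO) (hP : Fintype.card AI = Fintype.card P)
    (hF : Fintype.card BO = Fintype.card F) (h0 : ∀ i j b b', jumpA U a₀ b₀ i j b b' = 0) :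
    ∃ (U₀ : Matrix AI P ℂ) (U₁ : Matrix BI AO ℂ) (U₂ : Matrix F BO ℂ),
      IsUnitaryOp U₀ ∧ IsUnitaryOp U₁ ∧ IsUnitaryOp U₂ ∧ U = QSC.orderedAB U₀ U₁ U₂ := by
  obtain ⟨p₀⟩ : Nonempty P := by
    rw [← Fintype.card_pos_iff, ← hP]
    exact Fintype.card_pos
  obtain ⟨-, -, M, hM, hX, -⟩ := h.isometry_of_orderedA hU a₀ b₀ (v := Pi.single p₀ 1)
    (by intro h1; simpa using congrFun h1 p₀) (fun i j b b' => by rw [h0, Matrix.zero_mulVec])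
  have hMu := isUnitaryOp_of_isometry hM hP
  obtain ⟨N, J, hN, hJ, hform⟩ := h.product_form hU a₀ b₀ hB hM hX (fun k l a a' => by
    rw [← Matrix.mul_assoc, hMu.2, Matrix.one_mul])
  refine ⟨M.conjTranspose, N, J, ⟨by simpa using hMu.2, by simpa using hMu.1⟩, hN,
    isUnitaryOp_of_isometry hJ hF, ?_⟩
  ext ⟨i, k, f⟩ ⟨p, a, b⟩
  have h1 : blockOp U i k a b = blockOp U i k a b * M * M.conjTranspose := by
    rw [Matrix.mul_assoc, hMu.2, Matrix.mul_one]
  have h2 := congrFun (congrFun h1 f) p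
  rw [Matrix.mul_apply] at h2
  simp only [hform, ite_mul, zero_mul, Finset.sum_ite_eq, Finset.mem_univ, if_true] at h2
  refine Eq.trans h2 ?_
  simp only [QSC.orderedAB, Matrix.kronecker_apply]
  ring

theorem swapOp_eq_orderedAB {U : Matrix (AI × BI × F) (P × AO × BO) ℂ} {V₀ : Matrix BI P ℂ}
    {V₁ : Matrix AI BO ℂ} {V₂ : Matrix F AO ℂ} (h : swapOp U = orderedAB V₀ V₁ V₂) :
    U = orderedBA V₀ V₁ V₂ := by
  ext ⟨i, k, f⟩ ⟨p, a, b⟩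
  have h1 := congrFun (congrFun h (k, i, f)) (p, b, a)
  refine Eq.trans h1 ?_
  simp only [orderedAB, orderedBA, Matrix.kronecker_apply, Matrix.submatrix_apply, id]
  ring

end TwoSlots

/-- Two operators with orthogonal ranges, controlled by a qubit. -/
def qubitOp {Q X Y : Type} {d : ℕ} (A : Matrix Q X ℂ) (B : Matrix Q Y ℂ) (e : Fin d ≃ X)
    (g : Fin d ≃ Y) : Matrix Q (Fin 2 × Fin d) ℂ :=
  Matrix.of fun q z => if z.1 = 0 then A q (e z.2) else B q (g z.2)

theorem isUnitaryOp_qubitOp {Q X Y : Type} [Fintype Q] [DecidableEq Q] [Fintype X] [DecidableEq X]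
    [Fintype Y] [DecidableEq Y] {d : ℕ} {A : Matrix Q X ℂ} {B : Matrix Q Y ℂ} (e : Fin d ≃ X)
    (g : Fin d ≃ Y) (hA : A.conjTranspose * A = 1) (hB : B.conjTranspose * B = 1)
    (hBA : B.conjTranspose * A = 0) (hQ : Fintype.card Q = 2 * d) :
    IsUnitaryOp (qubitOp A B e g) := by
  have hAB : A.conjTranspose * B = 0 := by
    simpa using congrArg Matrix.conjTranspose hBA
  refine isUnitaryOp_of_isometry ?_ (by simp [hQ])
  ext ⟨c, t⟩ ⟨c', t'⟩
  have h1 := congrFun (congrFun hA (e t)) (e t')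
  have h2 := congrFun (congrFun hB (g t)) (g t')
  have h3 := congrFun (congrFun hAB (e t)) (g t')
  have h4 := congrFun (congrFun hBA (g t)) (e t')
  rw [Matrix.mul_apply] at h1 h2 h3 h4
  simp only [Matrix.conjTranspose_apply] at h1 h2 h3 h4
  rw [Matrix.mul_apply]
  fin_cases c <;> fin_cases c' <;>
    simp [qubitOp, Matrix.one_apply] at h1 h2 h3 h4 ⊢ <;> assumption

theorem qubitOp_mul_conjTranspose {Q X Y : Type} [Fintype X] [Fintype Y] {d : ℕ}
    (A : Matrix Q X ℂ) (B : Matrix Q Y ℂ) (e : Fin d ≃ X) (g : Fin d ≃ Y) :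
    qubitOp A B e g * (qubitOp A B e g).conjTranspose =
      A * A.conjTranspose + B * B.conjTranspose := by
  ext p q
  simp only [Matrix.mul_apply, Matrix.add_apply, Matrix.conjTranspose_apply, Fintype.sum_prod_type,
    Fin.sum_univ_two, qubitOp, Matrix.of_apply]
  simp only [if_true, Fin.one_eq_zero_iff, OfNat.ofNat_ne_one, if_false]
  rw [← e.sum_comp, ← g.sum_comp]

/-- The identification of `ℂ^X` with `ℂ^d`. -/
def equivOp {X : Type} [DecidableEq X] {d : ℕ} (e : Fin d ≃ X) : Matrix X (Fin d) ℂ :=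
  Matrix.of fun x t => if x = e t then 1 else 0

theorem isUnitaryOp_equivOp {X : Type} [Fintype X] [DecidableEq X] {d : ℕ} (e : Fin d ≃ X) :
    IsUnitaryOp (equivOp e) := by
  refine isUnitaryOp_of_isometry ?_ (Fintype.card_congr e)
  ext s t
  by_cases h : s = t
  · simp [equivOp, Matrix.mul_apply, Matrix.one_apply, h]
  · simp [equivOp, Matrix.mul_apply, h, Ne.symm h]

theorem IsUnitaryOp.conjTranspose {X Y : Type} [Fintype X] [DecidableEq X] [Fintype Y]
    [DecidableEq Y] {A : Matrix Y X ℂ} (h : IsUnitaryOp A) : IsUnitaryOp A.conjTranspose :=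
  ⟨by simpa using h.2, by simpa using h.1⟩

/-! ### Assembling the switch from two orthogonal ordered parts -/

section TwoSlots

variable {P AI AO BI BO F : Type}
  [Fintype P] [DecidableEq P] [Fintype AI] [DecidableEq AI] [Fintype AO] [DecidableEq AO]
  [Fintype BI] [DecidableEq BI] [Fintype BO] [DecidableEq BO] [Fintype F] [DecidableEq F]

theorem IsUnitaryOp.exists_ne_zero {X Y : Type} [Fintype X] [DecidableEq X] [Fintype Y]
    [DecidableEq Y] {A : Matrix Y X ℂ} (h : IsUnitaryOp A) (x : X) : ∃ y, A y x ≠ 0 := by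
  by_contra! h0
  have h1 := congrFun (congrFun h.1 x) x
  simp [Matrix.mul_apply, h0] at h1

/-- Orthogonality of the outputs of two ordered parts. -/
theorem orthogonal_outputs {U : Matrix (AI × BI × F) (P × AO × BO) ℂ} (hU : IsUnitaryOp U)
    (a₀ : AO) (b₀ : BO) {MA : Matrix P AI ℂ} {MB : Matrix P BI ℂ}
    (hM : MB.conjTranspose * MA = 0) {NA : Matrix BI AO ℂ} {JA : Matrix F BO ℂ}
    {NB : Matrix AI BO ℂ} {JB : Matrix F AO ℂ} (hNA : IsUnitaryOp NA) (hNB : IsUnitaryOp NB)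
    (hA : ∀ i k a b f i', (blockOp U i k a b * MA) f i' = if i = i' then NA k a * JA f b else 0)
    (hB : ∀ i k a b f k', (blockOp U i k a b * MB) f k' = if k = k' then NB i b * JB f a else 0) :
    JB.conjTranspose * JA = 0 := by
  obtain ⟨k', hk'⟩ := hNA.exists_ne_zero a₀
  obtain ⟨i', hi'⟩ := hNB.exists_ne_zero b₀
  ext a b
  -- The identity UᴴU = 1, compressed between the orthogonal inputs MB and MA, is zero. At the entry
  -- (k', i') only one term survives, and its coefficient was chosen nonzero.
  have h1 := congrArg (fun A => MB.conjTranspose * (A * MA))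
    (sum_conjTranspose_mul_blockOp hU a a₀ b₀ b)
  simp only [Matrix.sum_mul, Matrix.mul_sum, matrix_ite_mul, matrix_mul_ite, Matrix.one_mul, hM,
    ite_self] at h1
  have h2 : ∀ i k, MB.conjTranspose *
      ((blockOp U i k a b₀).conjTranspose * blockOp U i k a₀ b * MA) =
      (blockOp U i k a b₀ * MB).conjTranspose * (blockOp U i k a₀ b * MA) := fun i k => by
    rw [Matrix.conjTranspose_mul]
    simp only [Matrix.mul_assoc]
  have h3 : ∀ i k, ((blockOp U i k a b₀ * MB).conjTranspose * (blockOp U i k a₀ b * MA)) k' i' =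
      if i = i' then if k = k' then star (NB i b₀) * NA k a₀ * (JB.conjTranspose * JA) a b
        else 0 else 0 := fun i k => by
    rw [Matrix.mul_apply, Matrix.mul_apply]
    simp only [Matrix.conjTranspose_apply, hA, hB]
    by_cases hi : i = i' <;> by_cases hk : k = k'
    · simp only [hi, hk, if_true, Finset.mul_sum, star_mul']
      exact Finset.sum_congr rfl fun f _ => by ring
    all_goals simp [hi, hk]
  have h4 := congrFun (congrFun h1 k') i'
  simp only [h2, Matrix.sum_apply, h3, Finset.sum_ite_irrel, Finset.sum_const_zero,
    Finset.sum_ite_eq', Finset.mem_univ, if_true, Matrix.zero_apply] at h4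
  have h5 : star (NB i' b₀) * NA k' a₀ ≠ 0 := mul_ne_zero (star_ne_zero.2 hi') hk'
  exact (mul_eq_zero.1 h4).resolve_left h5

theorem choiVec_controlled_add {Pt Ft : Type} (U₀ : Matrix AI Pt ℂ) (U₁ : Matrix BI AO ℂ)
    (U₂ : Matrix Ft BO ℂ) (V₀ : Matrix BI Pt ℂ) (V₁ : Matrix AI BO ℂ) (V₂ : Matrix Ft AO ℂ) :
    choiVec (controlled 0 (orderedAB U₀ U₁ U₂) + controlled 1 (orderedBA V₀ V₁ V₂)) =
      controlledVecAB 0 U₀ U₁ U₂ + controlledVecBA 1 V₀ V₁ V₂ := by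
  ext ⟨⟨⟨pc, pt⟩, ao, bo⟩, ⟨ai, bi, ⟨fc, ft⟩⟩⟩
  fin_cases pc <;> fin_cases fc <;>
    simp [choiVec, controlled, orderedAB, orderedBA, controlledVecAB, controlledVecBA] <;> ring

/-- If neither slot is always the first one, `U` is a quantum switch. -/
theorem Admissible.switch_like {U : Matrix (AI × BI × F) (P × AO × BO) ℂ} (h : Admissible U)
    (hU : IsUnitaryOp U) (a₀ : AO) (b₀ : BO) {d : ℕ} (eAI : Fin d ≃ AI) (eAO : Fin d ≃ AO)
    (eBI : Fin d ≃ BI) (eBO : Fin d ≃ BO) (hP : Fintype.card P = 2 * d)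
    (hF : Fintype.card F = 2 * d) {MA : Matrix P AI ℂ} {MB : Matrix P BI ℂ}
    (hMA : MA.conjTranspose * MA = 1) (hMB : MB.conjTranspose * MB = 1)
    (hMBA : MB.conjTranspose * MA = 0)
    (hX : ∀ i j b b', unitsA U a₀ i j b b' * MA =
      if b = b' then MA * Matrix.single i j (1 : ℂ) else 0)
    (hY : ∀ k l a a', unitsB U b₀ k l a a' * MB =
      if a = a' then MB * Matrix.single k l (1 : ℂ) else 0)
    (hYA : ∀ k l a a', MB.conjTranspose * (unitsB U b₀ k l a a' * MA) = 0)
    (hXB : ∀ i j b b', MA.conjTranspose * (unitsA U a₀ i j b b' * MB) = 0) :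
    ∃ (S : Matrix P (Fin 2 × Fin d) ℂ) (T : Matrix F (Fin 2 × Fin d) ℂ)
        (U₀ : Matrix AI (Fin d) ℂ) (U₁ : Matrix BI AO ℂ) (U₂ : Matrix (Fin d) BO ℂ)
        (V₀ : Matrix BI (Fin d) ℂ) (V₁ : Matrix AI BO ℂ) (V₂ : Matrix (Fin d) AO ℂ),
        IsUnitaryOp S ∧ IsUnitaryOp T ∧
        IsUnitaryOp U₀ ∧ IsUnitaryOp U₁ ∧ IsUnitaryOp U₂ ∧
        IsUnitaryOp V₀ ∧ IsUnitaryOp V₁ ∧ IsUnitaryOp V₂ ∧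
        changeBasis S T U =
          controlled 0 (QSC.orderedAB U₀ U₁ U₂) + controlled 1 (QSC.orderedBA V₀ V₁ V₂) ∧
        choiVec (changeBasis S T U) =
          controlledVecAB 0 U₀ U₁ U₂ + controlledVecBA 1 V₀ V₁ V₂ := by
  have hS := isUnitaryOp_qubitOp eAI eBI hMA hMB hMBA hP
  -- Since D = 2d the two ranges fill `P`; orthogonality of the images then upgrades to invariance
  -- of each range.
  have hsum : MA * MA.conjTranspose + MB * MB.conjTranspose = 1 := by
    rw [← qubitOp_mul_conjTranspose MA MB eAI eBI, hS.2]
  have hne : Nonempty AI := ⟨eAI (eAO.symm a₀)⟩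
  have hne' : Nonempty BI := ⟨eBI (eAO.symm a₀)⟩
  have hBA : Fintype.card BI = Fintype.card AO := Fintype.card_congr (eBI.symm.trans eAO)
  have hAB : Fintype.card AI = Fintype.card BO := Fintype.card_congr (eAI.symm.trans eBO)
  obtain ⟨NA, JA, hNA, hJA, hA⟩ := h.product_form hU a₀ b₀ hBA hMA hX (fun k l a a' => by
    have h1 : (MA * MA.conjTranspose + MB * MB.conjTranspose) * (unitsB U b₀ k l a a' * MA) =
        unitsB U b₀ k l a a' * MA := by rw [hsum, Matrix.one_mul]
    rw [Matrix.add_mul, Matrix.mul_assoc MB, hYA, Matrix.mul_zero, add_zero, Matrix.mul_assoc] at h1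
    exact h1.symm)
  obtain ⟨NB, JB, hNB, hJB, hB'⟩ := h.swap.product_form (isUnitaryOp_swapOp hU) b₀ a₀ hAB hMB hY
    (fun i j b b' => by
      have h1 : (MA * MA.conjTranspose + MB * MB.conjTranspose) * (unitsA U a₀ i j b b' * MB) =
          unitsA U a₀ i j b b' * MB := by rw [hsum, Matrix.one_mul]
      rw [Matrix.add_mul, Matrix.mul_assoc MA, hXB, Matrix.mul_zero, zero_add,
        Matrix.mul_assoc] at h1
      exact h1.symm)
  have hB : ∀ i k a b f k', (blockOp U i k a b * MB) f k' =
      if k = k' then NB i b * JB f a else 0 := fun i k a b f k' => hB' k i b a f k'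
  have hJBA := orthogonal_outputs hU a₀ b₀ hMBA hNA hNB hA hB
  have hJAB : JA.conjTranspose * JB = 0 := by
    simpa using congrArg Matrix.conjTranspose hJBA
  -- The bases S and T absorb MA, MB, JA, JB. Only NA and NB remain as nontrivial unitaries; the
  -- other four are relabelings of bases.
  have hform : changeBasis (qubitOp MA MB eAI eBI) (qubitOp JA JB eBO eAO) U =
      controlled 0 (QSC.orderedAB (equivOp eAI) NA (equivOp eBO).conjTranspose) +
        controlled 1 (QSC.orderedBA (equivOp eBI) NB (equivOp eAO).conjTranspose) := by
    ext ⟨i, k, ⟨c, t⟩⟩ ⟨⟨c', t'⟩, a, b⟩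
    rw [changeBasis_apply]
    have hJ : ∀ {X Y : Type} (A : Matrix F X ℂ) (B : Matrix F Y ℂ) (x : X) (y : Y),
        ∑ f, star (A f x) * B f y = (A.conjTranspose * B) x y := fun A B x y => rfl
    have hA' : ∀ f, ∑ p, U (i, k, f) (p, a, b) * MA p (eAI t') =
        if i = eAI t' then NA k a * JA f b else 0 := fun f => hA i k a b f (eAI t')
    have hB'' : ∀ f, ∑ p, U (i, k, f) (p, a, b) * MB p (eBI t') =
        if k = eBI t' then NB i b * JB f a else 0 := fun f => hB i k a b f (eBI t')
    -- Equal control values use that JA and JB are isometries; different ones use that their ranges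
    -- are orthogonal.
    fin_cases c' <;> fin_cases c
    · simp only [qubitOp, Matrix.of_apply, Fin.zero_eta, if_true, hA']
      by_cases hi : i = eAI t'
      · simp only [hi, if_true, mul_left_comm _ (NA k a), ← Finset.mul_sum, hJ, hJA]
        simp [controlled, QSC.orderedAB, equivOp, Matrix.one_apply, eq_comm]
      · simp [hi, controlled, QSC.orderedAB, equivOp]
    · simp only [qubitOp, Matrix.of_apply, Fin.zero_eta, Fin.mk_one, one_ne_zero, if_true, hA',
        if_false]
      by_cases hi : i = eAI t'
      · simp only [hi, if_true, mul_left_comm _ (NA k a), ← Finset.mul_sum, hJ, hJBA]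
        simp [controlled]
      · simp [hi, controlled]
    · simp only [qubitOp, Matrix.of_apply, Fin.zero_eta, Fin.mk_one, one_ne_zero, if_true, hB'',
        if_false]
      by_cases hi : k = eBI t'
      · simp only [hi, if_true, mul_left_comm _ (NB i b), ← Finset.mul_sum, hJ, hJAB]
        simp [controlled]
      · simp [hi, controlled]
    · simp only [qubitOp, Matrix.of_apply, Fin.mk_one, one_ne_zero, if_false, hB'']
      by_cases hi : k = eBI t'
      · simp only [hi, if_true, mul_left_comm _ (NB i b), ← Finset.mul_sum, hJ, hJB]
        simp [controlled, QSC.orderedBA, equivOp, Matrix.one_apply, eq_comm]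
      · simp [hi, controlled, QSC.orderedBA, equivOp]
  refine ⟨_, _, _, _, _, _, _, _, hS, isUnitaryOp_qubitOp eBO eAO hJA hJB hJBA hF,
    isUnitaryOp_equivOp eAI, hNA, (isUnitaryOp_equivOp eBO).conjTranspose,
    isUnitaryOp_equivOp eBI, hNB, (isUnitaryOp_equivOp eAO).conjTranspose, hform, ?_⟩
  rw [hform, choiVec_controlled_add]

end TwoSlots

end QSC

/-! ### The main theorem: which jumps vanish -/

theorem mainTheorem6
    {P AI AO BI BO F : Type}
    [Fintype P] [DecidableEq P] [Fintype AI] [DecidableEq AI] [Fintype AO] [DecidableEq AO]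
    [Fintype BI] [DecidableEq BI] [Fintype BO] [DecidableEq BO] [Fintype F] [DecidableEq F]
    (d D : ℕ)
    (hAI : Fintype.card AI = d) (hAO : Fintype.card AO = d)
    (hBI : Fintype.card BI = d) (hBO : Fintype.card BO = d)
    (hP : Fintype.card P = D) (hF : Fintype.card F = D)
    (U : Matrix (AI × BI × F) (P × AO × BO) ℂ)
    (hU : QSC.RepresentsPureSuperchannel U ∨ QSC.RepresentsDirectSumOfPureCombs U) :
    (D = d →
      QSC.IsCausallyOrdered U ∧
      ((∃ (U₀ : Matrix AI P ℂ) (U₁ : Matrix BI AO ℂ) (U₂ : Matrix F BO ℂ),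
          QSC.IsUnitaryOp U₀ ∧ QSC.IsUnitaryOp U₁ ∧ QSC.IsUnitaryOp U₂ ∧
          U = QSC.orderedAB U₀ U₁ U₂) ∨
       (∃ (V₀ : Matrix BI P ℂ) (V₁ : Matrix AI BO ℂ) (V₂ : Matrix F AO ℂ),
          QSC.IsUnitaryOp V₀ ∧ QSC.IsUnitaryOp V₁ ∧ QSC.IsUnitaryOp V₂ ∧
          U = QSC.orderedBA V₀ V₁ V₂))) ∧
    (D = 2 * d →
      QSC.IsCausallyOrdered U ∨
      ∃ (S : Matrix P (Fin 2 × Fin d) ℂ) (T : Matrix F (Fin 2 × Fin d) ℂ)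
        (U₀ : Matrix AI (Fin d) ℂ) (U₁ : Matrix BI AO ℂ) (U₂ : Matrix (Fin d) BO ℂ)
        (V₀ : Matrix BI (Fin d) ℂ) (V₁ : Matrix AI BO ℂ) (V₂ : Matrix (Fin d) AO ℂ),
        QSC.IsUnitaryOp S ∧ QSC.IsUnitaryOp T ∧
        QSC.IsUnitaryOp U₀ ∧ QSC.IsUnitaryOp U₁ ∧ QSC.IsUnitaryOp U₂ ∧
        QSC.IsUnitaryOp V₀ ∧ QSC.IsUnitaryOp V₁ ∧ QSC.IsUnitaryOp V₂ ∧
        QSC.changeBasis S T U =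
          QSC.controlled 0 (QSC.orderedAB U₀ U₁ U₂) +
            QSC.controlled 1 (QSC.orderedBA V₀ V₁ V₂) ∧
        QSC.choiVec (QSC.changeBasis S T U) =
          QSC.controlledVecAB 0 U₀ U₁ U₂ + QSC.controlledVecBA 1 V₀ V₁ V₂) := by
  open QSC in
  -- In dimension zero the equalities hold because all matrices are empty.
  have hzero : d = 0 → D = 0 → IsUnitaryOp U → IsCausallyOrdered U ∧
      ∃ (U₀ : Matrix AI P ℂ) (U₁ : Matrix BI AO ℂ) (U₂ : Matrix F BO ℂ),
          IsUnitaryOp U₀ ∧ IsUnitaryOp U₁ ∧ IsUnitaryOp U₂ ∧ U = orderedAB U₀ U₁ U₂ := by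
    rintro rfl rfl hU
    have := Fintype.card_eq_zero_iff.1 hP
    have := Fintype.card_eq_zero_iff.1 hAI
    have := Fintype.card_eq_zero_iff.1 hAO
    have := Fintype.card_eq_zero_iff.1 hBI
    have := Fintype.card_eq_zero_iff.1 hBO
    have := Fintype.card_eq_zero_iff.1 hF
    exact ⟨Or.inl (representsCombAB_of_isEmpty hU), 0, 0, 0, ⟨Subsingleton.elim _ _,
      Subsingleton.elim _ _⟩, ⟨Subsingleton.elim _ _, Subsingleton.elim _ _⟩,
      ⟨Subsingleton.elim _ _, Subsingleton.elim _ _⟩, Subsingleton.elim _ _⟩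
  have hUU : QSC.IsUnitaryOp U := hU.elim (fun h => h.1) (fun h => h.1)
  rcases Nat.eq_zero_or_pos d with hd | hd
  · refine ⟨fun hD => ?_, fun hD => Or.inl (hzero hd (by omega) hUU).1⟩
    exact ⟨(hzero hd (by omega) hUU).1, Or.inl (hzero hd (by omega) hUU).2⟩
  have hnAI : Nonempty AI := Fintype.card_pos_iff.1 (hAI ▸ hd)
  have hnBI : Nonempty BI := Fintype.card_pos_iff.1 (hBI ▸ hd)
  have hnAO : Nonempty AO := Fintype.card_pos_iff.1 (hAO ▸ hd)
  have hnBO : Nonempty BO := Fintype.card_pos_iff.1 (hBO ▸ hd)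
  obtain ⟨a₀⟩ := id hnAO
  obtain ⟨b₀⟩ := id hnBO
  have h := (QSC.admissible_of_represents hU).2
  have hU' := QSC.isUnitaryOp_swapOp hUU
  by_cases hA : ∀ i j b b', QSC.jumpA U a₀ b₀ i j b b' = 0
  · have hc : QSC.IsCausallyOrdered U := Or.inl ((h.orderedAB hUU a₀ b₀ hA).representsCombAB hUU)
    exact ⟨fun hD => ⟨hc, Or.inl (h.eq_orderedAB hUU a₀ b₀ (by omega) (by omega) (by omega) hA)⟩,
      fun _ => Or.inl hc⟩
  by_cases hB : ∀ k l a a', QSC.jumpB U a₀ b₀ k l a a' = 0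
  · have hc : QSC.IsCausallyOrdered U :=
      Or.inr ((h.swap.orderedAB hU' b₀ a₀ hB).representsCombBA hUU)
    refine ⟨fun hD => ⟨hc, Or.inr ?_⟩, fun _ => Or.inl hc⟩
    obtain ⟨V₀, V₁, V₂, h₀, h₁, h₂, hV⟩ :=
      h.swap.eq_orderedAB hU' b₀ a₀ (by omega) (by omega) (by omega) hB
    exact ⟨V₀, V₁, V₂, h₀, h₁, h₂, QSC.swapOp_eq_orderedAB hV⟩
  -- Both kinds of jumps occur from here on, which yields the two orthogonal copies inside `P`.
  obtain ⟨MA, hMA, hX, k, l, a, a', R, hR⟩ := h.isometry_of_jumpB hUU a₀ b₀ hB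
  obtain ⟨MB, hMB, hY, i, j, b, b', R', hR'⟩ := h.swap.isometry_of_jumpB hU' b₀ a₀ hA
  have hR'' : MB = QSC.jumpA U a₀ b₀ i j b b' * R' := hR'
  obtain ⟨hMBA, hYA⟩ := h.orthogonal hUU a₀ b₀ i j b b' k l a a' R R'
  obtain ⟨-, hXB⟩ := h.swap.orthogonal hU' b₀ a₀ k l a a' i j b b' R' R
  rw [← hR, ← hR''] at hMBA
  refine ⟨fun hD => ?_, fun hD => Or.inr ?_⟩
  · exfalso
    -- For D = d the first copy is already all of `P`, leaving no room for the second.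
    have hMAu := QSC.isUnitaryOp_of_isometry hMA (by omega)
    have h1 : MB.conjTranspose = 0 := by
      rw [← Matrix.mul_one MB.conjTranspose, ← hMAu.2, ← Matrix.mul_assoc, hMBA, Matrix.zero_mul]
    rw [h1, Matrix.zero_mul] at hMB
    exact zero_ne_one hMB
  · refine h.switch_like hUU a₀ b₀ (Fintype.equivFinOfCardEq hAI).symm
      (Fintype.equivFinOfCardEq hAO).symm (Fintype.equivFinOfCardEq hBI).symm
      (Fintype.equivFinOfCardEq hBO).symm (hP.trans hD) (hF.trans hD) hMA hMB hMBA hX hY ?_ ?_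
    · intro m n c c'
      rw [hR, hR'']
      exact hYA m n c c'
    · intro m n c c'
      rw [hR, hR'']
      exact hXB m n c c'
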